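/- Let $S_n$ act on $n$ qubits $(\mathbb{C}^2)^{\otimes n}$ by $\pi(\sigma)(e_{x_1}\otimes\cdots\otimes e_{x_n}) = e_{x_{\sigma^{-1}(1)}}\otimes\cdots\otimes e_{x_{\sigma^{-1}(n)}}$, let $\widetilde\pi(f)=\sum_i c_i\,\pi(\sigma_i)$ for $f=\sum_i c_i\sigma_i\in\mathbb{C}[S_n]$, and call $f$ $k$-local if every $\sigma_i$ with $c_i\neq 0$ moves at most $k$ points. Put $L(k)=\max_i|c_i|\,2^{k-1}$. For a standard Young tableau $T$ with $n$ boxes and an integer $m$, let $|v_T^\mu\rangle$, $\mu=(n-m,m)$, denote a Young basis vector: a unit vector in the permutation module $M^\mu$ (the span of the computational basis vectors with exactly $m$ qubits in state $1$) which is a joint eigenvector of the Young-Jucys-Murphy elements $X_i=\sum_{j<i}(j\;i)$ whose eigenvalues are the contents of $T$. A circuit acts on the $n$ system qubits and on $a$ ancilla qubits that start in $|0\cdots 0\rangle$. It is a product of unitaries acting on the ancillas alone, which are not counted, and of Pauli gates $\sum_j P_j\otimes|j\rangle\langle j|$, where $j$ runs over the computational basis of the ancillas and each $P_j$ is a tensor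 product of Pauli operators $I,X,Y,Z$ with at most $k$ non-identity factors on the system. Each such gate counts as one Pauli gate. **Theorem.** (1) For $i\neq j$, $\pi((i\;j)) = 2\,\boldsymbol S_i\cdot\boldsymbol S_j+\tfrac12 I$, where $\boldsymbol S_i=\tfrac12(X_i,Y_i,Z_i)$ is here half the vector of Pauli operators on qubit $i$. (2) For every $f\in\mathbb{C}[S_n]$, $H=\widetilde\pi(f)$, every $t\in\mathbb{R}$, and all $T,T'$ of shapes $\lambda,\lambda'$ with at most two rows, the matrix elements of $\exp(-itH)$ in the Young basis are block diagonal: $$\langle v_{T'}^{\mu'}|\exp(-itH)|v_T^{\mu}\rangle=\delta_{\lambda',\lambda}\,\delta_{\mu',\mu}\,\langle v_{T'}^{\mu'}|\exp(-itH)|v_T^{\mu}\rangle .$$ (3) There is a universal constant $A>0$ such that the following holds for all $n$, all $k\ge1$, every $k$-local $f\in\mathbb{C}[S_n]$ for which $H=\widetilde\pi(f)$ is Hermitian, and all $t,\epsilon>0$ with $tL(k)n^k\ge1$ and $tL(k)n^k/\epsilon>e$. There is a circuit $W$ with at most $$A\; tL(k)n^k\,\frac{\log(tL(k)n^k/\epsilon)}{\log\log(tL(k)n^k/\epsilon)}$$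 Pauli gates, on at most $A\log(NK)$ ancilla qubits, where $N=(4n)^k$ and $K=\log(tL(k)n^k/\epsilon)/\log\log(tL(k)n^k/\epsilon)$, which simulates $\exp(-itH)$ up to error $\epsilon$: $$\bigl\| W(\psi\otimes|0\cdots0\rangle)-(\exp(-itH)\psi)\otimes|0\cdots0\rangle\bigr\|\le\epsilon\|\psi\|\quad\text{for every }\psi .$$ In particular it simulates all matrix elements in the Young basis: $$\bigl|\langle v_{T'}^{\mu'},0\cdots0|\,W\,|v_T^{\mu},0\cdots0\rangle-\langle v_{T'}^{\mu'}|\exp(-itH)|v_T^{\mu}\rangle\bigr|\le\epsilon\quad\text{for all }T,T',\mu,\mu'.$$ -/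

import Mathlib

open scoped Kronecker

noncomputable section

namespace QubitSim

/-! ### Qubits, the permutation representation and the group algebra -/

/-- Computational basis labels of `n` qubits. -/
abbrev Qubits (n : ℕ) : Type := Fin n → Fin 2

/-- The state space `(ℂ²)^{⊗ n}` with its Hilbert space structure. -/
abbrev State (n : ℕ) : Type := EuclideanSpace ℂ (Qubits n)

/-- Operators on `(ℂ²)^{⊗ n}`, as matrices in the computational basis. -/
abbrev Op (n : ℕ) : Type := Matrix (Qubits n) (Qubits n) ℂ

/-- The group algebra `ℂ[S_n]`. -/
abbrev GroupAlg (n : ℕ) : Type := MonoidAlgebra ℂ (Equiv.Perm (Fin n))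

/-- The permutation representation: `π(σ)` sends `e_{x_1} ⊗ ⋯ ⊗ e_{x_n}` to
`e_{x_{σ⁻¹(1)}} ⊗ ⋯ ⊗ e_{x_{σ⁻¹(n)}}`. -/
def permRep (n : ℕ) : Equiv.Perm (Fin n) →* Op n where
  toFun σ := Matrix.of fun y x => if y = x ∘ ⇑σ⁻¹ then 1 else 0
  map_one' := by
    ext y x
    simp [Matrix.one_apply]
  map_mul' σ τ := by
    ext y x
    simp only [Matrix.of_apply, Matrix.mul_apply, mul_ite, mul_one, mul_zero,
      Finset.sum_ite_eq', Finset.mem_univ, if_true]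
    rfl

/-- The induced representation `π̃ : ℂ[S_n] → End((ℂ²)^{⊗ n})`, `∑ c_i σ_i ↦ ∑ c_i π(σ_i)`. -/
def algRep (n : ℕ) : GroupAlg n →ₐ[ℂ] Op n :=
  MonoidAlgebra.lift ℂ (Op n) (Equiv.Perm (Fin n)) (permRep n)

/-- `f = ∑ c_i σ_i` is `k`-local: every permutation occurring in `f` moves at most `k` points. -/
def IsLocal {n : ℕ} (k : ℕ) (f : GroupAlg n) : Prop :=
  ∀ σ : Equiv.Perm (Fin n), f.coeff σ ≠ 0 → σ.support.card ≤ k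

/-- `L(k) = max_i |c_i| · 2^{k-1}` for `f = ∑ c_i σ_i` and `1 ≤ k`. -/
def lConst {n : ℕ} (k : ℕ) (f : GroupAlg n) : ℝ :=
  (Finset.univ.sup' ⟨1, Finset.mem_univ _⟩ fun σ : Equiv.Perm (Fin n) => ‖f.coeff σ‖) *
    2 ^ (k - 1)

/-- The evolution operator `exp(-i t H)`. -/
def evolution {n : ℕ} (H : Op n) (t : ℝ) : Op n :=
  NormedSpace.exp ((-(Complex.I * (t : ℂ))) • H)

/-! ### Pauli operators -/

/-- Labels of the single-qubit Pauli operators. -/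
inductive Pauli : Type
  | I
  | X
  | Y
  | Z
  deriving DecidableEq

/-- The single-qubit Pauli matrices. -/
def Pauli.mat : Pauli → Matrix (Fin 2) (Fin 2) ℂ
  | .I => 1
  | .X => !![0, 1; 1, 0]
  | .Y => !![0, -Complex.I; Complex.I, 0]
  | .Z => !![1, 0; 0, -1]

/-- The Pauli operator `P_1 ⊗ ⋯ ⊗ P_n` on `n` qubits. -/
def pauliOp {n : ℕ} (P : Fin n → Pauli) : Op n :=
  Matrix.of fun x y => ∏ i, (P i).mat (x i) (y i)

/-- The number of qubits on which `P_1 ⊗ ⋯ ⊗ P_n` acts nontrivially. -/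
def pauliWeight {n : ℕ} (P : Fin n → Pauli) : ℕ :=
  (Finset.univ.filter fun i => P i ≠ Pauli.I).card

/-- The component of the spin operator of the `i`-th qubit belonging to the Pauli label `p`,
i.e. one half of the Pauli operator `p` acting on qubit `i`. -/
def spin {n : ℕ} (p : Pauli) (i : Fin n) : Op n :=
  (1 / 2 : ℂ) • pauliOp (Function.update (fun _ => Pauli.I) i p)

/-- `S_i · S_j = S_i^x S_j^x + S_i^y S_j^y + S_i^z S_j^z`. -/
def spinDot {n : ℕ} (i j : Fin n) : Op n :=
  spin .X i * spin .X j + spin .Y i * spin .Y j + spin .Z i * spin .Z j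

/-! ### The Young basis -/

/-- A standard Young tableau of shape `lam` with `n` boxes: `box i` is the cell (row, column)
that contains the `i`-th entry, and entries increase along rows and columns. -/
structure StdTableau (n : ℕ) (lam : YoungDiagram) where
  box : Fin n → ℕ × ℕ
  injective : Function.Injective box
  image_eq : Finset.univ.image box = lam.cells
  increasing : ∀ i j, box i ≤ box j → i ≤ j

/-- The content (column minus row) of the box containing the `i`-th entry. -/
def StdTableau.content {n : ℕ} {lam : YoungDiagram} (T : StdTableau n lam) (i : Fin n) : ℤ :=
  ((T.box i).2 : ℤ) - ((T.box i).1 : ℤ)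

/-- The Young-Jucys-Murphy element `X_i = ∑_{j < i} (j i)`. -/
def yjm {n : ℕ} (i : Fin n) : GroupAlg n :=
  ∑ j ∈ Finset.univ.filter (fun j => j < i), MonoidAlgebra.single (Equiv.swap j i) 1

/-- `v` is (a choice of) the Young basis vector `|v_T^μ⟩` of `(ℂ²)^{⊗ n}`: a unit vector in the
permutation module `M^μ` spanned by the computational basis vectors with exactly `m` qubits in
state `1` (so that `μ = (n - m, m)`), which is a joint eigenvector of the Young-Jucys-Murphy
elements whose eigenvalues are the contents of `T`. -/
def IsYoungVector {n : ℕ} {lam : YoungDiagram} (T : StdTableau n lam) (m : ℕ)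
    (v : State n) : Prop :=
  ‖v‖ = 1 ∧
  (∀ x : Qubits n, (Finset.univ.filter fun i => x i = 1).card ≠ m → v x = 0) ∧
  ∀ i : Fin n, Matrix.toEuclideanLin (algRep n (yjm i)) v = (T.content i : ℂ) • v

/-! ### Circuits of Pauli gates -/

/-- The joint computational basis of `n` system qubits and `a` ancilla qubits. -/
abbrev Joint (n a : ℕ) : Type := Qubits n × Qubits a

/-- One step of a circuit on `n` system and `a` ancilla qubits: either a unitary that acts on the
ancilla qubits alone, or a Pauli gate, which applies to the system a Pauli operator of weight at
most `k` that is selected by the computational basis state of the ancilla qubits. -/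
inductive Gate (n k a : ℕ) : Type
  | ancilla (B : Matrix.unitaryGroup (Qubits a) ℂ) : Gate n k a
  | pauli (P : Qubits a → Fin n → Pauli) (hP : ∀ j, pauliWeight (P j) ≤ k) : Gate n k a

/-- The operator of a gate: `1 ⊗ B` for an ancilla unitary, `∑_j P_j ⊗ |j⟩⟨j|` for a Pauli
gate. -/
def Gate.op {n k a : ℕ} : Gate n k a → Matrix (Joint n a) (Joint n a) ℂ
  | .ancilla B => (1 : Op n) ⊗ₖ (B : Matrix (Qubits a) (Qubits a) ℂ)
  | .pauli P _ => Matrix.blockDiagonal fun j => pauliOp (P j)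

/-- A Pauli gate costs one, an ancilla unitary nothing. -/
def Gate.cost {n k a : ℕ} : Gate n k a → ℕ
  | .ancilla _ => 0
  | .pauli _ _ => 1

/-- A circuit is a list of gates, the first of which is applied last. -/
abbrev Circuit (n k a : ℕ) : Type := List (Gate n k a)

/-- The operator that a circuit implements. -/
def circuitOp {n k a : ℕ} (W : Circuit n k a) : Matrix (Joint n a) (Joint n a) ℂ :=
  (W.map Gate.op).prod

/-- The number of Pauli gates of a circuit. -/
def pauliCount {n k a : ℕ} (W : Circuit n k a) : ℕ :=
  (W.map Gate.cost).sum

/-- The joint state `ψ ⊗ |0…0⟩`. -/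
def withAncilla {n : ℕ} (a : ℕ) (ψ : State n) : EuclideanSpace ℂ (Joint n a) :=
  WithLp.toLp 2 fun p => if p.2 = 0 then ψ p.1 else 0

/-- The growth function `log x / log log x`. -/
def logRatio (x : ℝ) : ℝ := Real.log x / Real.log (Real.log x)

end QubitSim

end

open QubitSim

/-! The spin form is the two-qubit identity SWAP = ½(II + XX + YY + ZZ), checked entry by entry.

For the selection rules, `exp(-itH)` commutes with every operator that commutes with all `π(σ)`. Two
such Hermitian operators suffice. `weightOp` has eigenvalue `m` on `M^μ` and separates the
permutation modules. `swapSum`, the sum of all transpositions up to scaling and a multiple of the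
identity, has on a Young vector an eigenvalue determined by the sum of the contents of `T`. Among
shapes with `n` boxes and at most two rows that sum determines the shape (`eq_of_sum_content_eq`).
Eigenvectors with different eigenvalues have zero matrix element (`inner_eq_zero_of_commute`).

For the simulation, a permutation moving at most `k` points is a product of at most `k - 1`
transpositions, each of Pauli `ℓ¹`-norm at most 2, and there are at most `n^k` such permutations.
Hence `H` is a combination of Paulis of weight at most `k` with `ℓ¹`-norm at most `α = L(k) n^k`
(`absComb_algRep`). One Pauli gate between ancilla unitaries gives a self-adjoint block encoding of
`H/α` (`exists_block_encoding`), and a reflection turns it into a walk operator `W` with `½(W + Wᴴ)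
T = T (H/α)` for the ancilla isometry `T` (`exists_walk`). So it is enough to exponentiate `½(W +
Wᴴ)`.

The time `tα` is cut into `r = O(tα)` segments. In each, the Taylor polynomial with `N =
O(log/loglog)` terms is a combination of powers of `W`, implemented by controlled powers and one
round of oblivious amplitude amplification (`exists_segment`). Since only powers of a single `W`
occur, one register for the Pauli label and one counter for the exponent suffice, which gives
`O(log(NK))` ancillas instead of one label register for each Taylor factor. The errors of the
segments add up. The bound for matrix elements then follows from Cauchy-Schwarz. -/

noncomputable section

namespace QubitSim

open Matrix

section

open scoped Matrix.Norms.L2Operator Nat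

/-! ### Linear combinations with bounded `ℓ¹`-norm of the coefficients -/

/-- `X` is a linear combination of the `g i` whose coefficients have `ℓ¹`-norm at most `s`. -/
def AbsComb {ι A : Type*} [Fintype ι] [AddCommMonoid A] [Module ℂ A] (g : ι → A) (s : ℝ) (X : A) :
    Prop :=
  ∃ b : ι → ℂ, ∑ i, ‖b i‖ ≤ s ∧ X = ∑ i, b i • g i

namespace AbsComb

variable {ι κ ν A : Type*} [Fintype ι]

section Module
variable [AddCommMonoid A] [Module ℂ A] {g : ι → A} {r s : ℝ} {X Y : A}

theorem mono (h : AbsComb g r X) (hrs : r ≤ s) : AbsComb g s X := by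
  obtain ⟨b, hb, rfl⟩ := h
  exact ⟨b, hb.trans hrs, rfl⟩

theorem zero (g : ι → A) : AbsComb g 0 0 := ⟨0, by simp, by simp⟩

theorem of_index (g : ι → A) (i : ι) : AbsComb g 1 (g i) := by
  classical
  refine ⟨Pi.single i 1, ?_, ?_⟩
  · rw [Finset.sum_eq_single i] <;> simp +contextual
  · rw [Finset.sum_eq_single i] <;> simp +contextual

theorem add (hX : AbsComb g r X) (hY : AbsComb g s Y) : AbsComb g (r + s) (X + Y) := by
  obtain ⟨b, hb, rfl⟩ := hX
  obtain ⟨c, hc, rfl⟩ := hY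
  refine ⟨b + c, ?_, by simp [add_smul, Finset.sum_add_distrib]⟩
  calc ∑ i, ‖(b + c) i‖ ≤ ∑ i, (‖b i‖ + ‖c i‖) := Finset.sum_le_sum fun i _ => norm_add_le _ _
    _ ≤ r + s := by rw [Finset.sum_add_distrib]; exact add_le_add hb hc

theorem smul (c : ℂ) (hX : AbsComb g r X) : AbsComb g (‖c‖ * r) (c • X) := by
  obtain ⟨b, hb, rfl⟩ := hX
  refine ⟨c • b, ?_, by simp [Finset.smul_sum, smul_smul]⟩
  simp only [Pi.smul_apply, smul_eq_mul, norm_mul, ← Finset.mul_sum]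
  gcongr

theorem sum {t : Finset κ} {R : κ → ℝ} {Z : κ → A} (h : ∀ k ∈ t, AbsComb g (R k) (Z k)) :
    AbsComb g (∑ k ∈ t, R k) (∑ k ∈ t, Z k) := by
  classical
  induction t using Finset.induction_on with
  | empty => simpa using zero g
  | insert k t hk ih =>
    rw [Finset.sum_insert hk, Finset.sum_insert hk]
    exact (h k (by simp)).add (ih fun l hl => h l (by simp [hl]))

theorem subst [Fintype κ] {h : κ → A} (hX : AbsComb g r X) (hg : ∀ i, AbsComb h 1 (g i)) :
    AbsComb h r X := by
  obtain ⟨b, hb, rfl⟩ := hX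
  exact (sum fun i _ => (hg i).smul (b i)).mono (by simpa using hb)

end Module

/-- Submultiplicativity of the `ℓ¹`-norm. It applies to Pauli operators because their products are
Pauli operators up to a phase. -/
theorem mul [Fintype κ] [Fintype ν] [Ring A] [Algebra ℂ A] {g : ι → A} {h : κ → A} {l : ν → A} {r s : ℝ} {X Y : A}
    (hX : AbsComb g r X) (hY : AbsComb h s Y) (hgh : ∀ i j, AbsComb l 1 (g i * h j)) :
    AbsComb l (r * s) (X * Y) := by
  obtain ⟨b, hb, rfl⟩ := hX
  obtain ⟨c, hc, rfl⟩ := hY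
  have : AbsComb l (∑ i, ∑ j, ‖b i * c j‖ * 1) (∑ i, ∑ j, (b i * c j) • (g i * h j)) :=
    sum fun i _ => sum fun j _ => (hgh i j).smul _
  rw [Finset.sum_mul_sum]
  simp only [smul_mul_smul_comm]
  refine this.mono ?_
  simp only [norm_mul, mul_one]
  rw [← Finset.sum_mul_sum]
  exact mul_le_mul hb hc (Finset.sum_nonneg fun _ _ => norm_nonneg _)
    ((Finset.sum_nonneg fun _ _ => norm_nonneg _).trans hb)

end AbsComb

/-! ### Exponentials -/

/-- The tail is dominated termwise by the tail of the real exponential series at `‖X‖ ≤ 1`. -/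
theorem norm_exp_sub_sum_le {A : Type*} [NormedRing A] [NormedAlgebra ℂ A] [CompleteSpace A]
    (X : A) (hX : ‖X‖ ≤ 1) {N : ℕ} (hN : 0 < N) :
    ‖NormedSpace.exp X - ∑ j ∈ Finset.range N, ((j ! : ℂ)⁻¹) • X ^ j‖ ≤ 2 / (N ! : ℝ) := by
  have h1 := (NormedSpace.exp_series_hasSum_exp' (𝕂 := ℂ) X)
  have h1' := (hasSum_nat_add_iff' N).2 h1
  have h2 := (NormedSpace.exp_series_hasSum_exp' (𝕂 := ℝ) ‖X‖)
  have h2' := (hasSum_nat_add_iff' N).2 h2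
  have hb : ∀ j : ℕ, ‖(((j + N) ! : ℂ)⁻¹) • X ^ (j + N)‖ ≤ (((j + N) ! : ℝ)⁻¹) • ‖X‖ ^ (j + N) := by
    intro j
    rw [norm_smul]
    simp only [norm_inv, smul_eq_mul, Complex.norm_natCast]
    gcongr
    exact norm_pow_le' X (by omega)
  have h3 := h1'.norm_le_of_bounded h2' hb
  refine h3.trans ?_
  have h4 := Real.exp_bound (x := ‖X‖) (by simpa using hX) hN
  have h5 : NormedSpace.exp ‖X‖ - ∑ i ∈ Finset.range N, ((i ! : ℝ)⁻¹) • ‖X‖ ^ i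
      = Real.exp ‖X‖ - ∑ m ∈ Finset.range N, ‖X‖ ^ m / (m ! : ℝ) := by
    rw [Real.exp_eq_exp_ℝ]
    simp [div_eq_inv_mul]
  rw [h5]
  refine (le_abs_self _).trans (h4.trans ?_)
  have hN1 : (1 : ℝ) ≤ N := by exact_mod_cast hN
  have hf : (0 : ℝ) < N ! := by exact_mod_cast Nat.factorial_pos N
  have h6 : |‖X‖| ^ N ≤ 1 := pow_le_one₀ (abs_nonneg _) (by simpa using hX)
  calc |‖X‖| ^ N * ((N.succ : ℝ) / (N ! * N)) ≤ 1 * ((N.succ : ℝ) / (N ! * N)) := by gcongr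
    _ ≤ 2 / N ! := by
      rw [one_mul, div_le_div_iff₀ (by positivity) hf]
      push_cast
      nlinarith

/-- With `T` a rectangular isometry, this transfers the evolution under the walk's Hermitian part to
the evolution under `H`, without any spectral analysis. -/
theorem exp_mul_eq_mul_exp {m n : Type*} [Fintype m] [DecidableEq m] [Fintype n] [DecidableEq n]
    {Q : Matrix m m ℂ} {T : Matrix m n ℂ} {H : Matrix n n ℂ} (h : Q * T = T * H) :
    NormedSpace.exp Q * T = T * NormedSpace.exp H := by
  have hp : ∀ j : ℕ, Q ^ j * T = T * H ^ j := by
    intro j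
    induction j with
    | zero => simp
    | succ j ih => rw [pow_succ, pow_succ, Matrix.mul_assoc, h, ← Matrix.mul_assoc, ih,
        Matrix.mul_assoc]
  have h1 := NormedSpace.exp_series_hasSum_exp' (𝕂 := ℂ) Q
  have h2 := NormedSpace.exp_series_hasSum_exp' (𝕂 := ℂ) H
  have h3 := h1.map (⟨⟨fun M => M * T, by simp⟩, fun a b => Matrix.add_mul a b T⟩ :
    Matrix m m ℂ →+ Matrix m n ℂ) (Continuous.matrix_mul continuous_id continuous_const)
  have h4 := h2.map (⟨⟨fun M => T * M, by simp⟩, fun a b => Matrix.mul_add T a b⟩ :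
    Matrix n n ℂ →+ Matrix m n ℂ) (Continuous.matrix_mul continuous_const continuous_id)
  refine h3.unique ?_
  convert h4 using 1
  · ext1 j
    simp [hp]
  · rfl

/-! ### Tensoring with an ancilla vector -/

section Emb
variable {E C : Type*} [DecidableEq E]

/-- The operator `ψ ↦ ψ ⊗ v`. -/
def emb (E : Type*) [DecidableEq E] {C : Type*} (v : C → ℂ) : Matrix (E × C) E ℂ :=
  Matrix.of fun p e => if p.1 = e then v p.2 else 0

variable [Fintype E] [Fintype C]

/-- The linear-combination-of-unitaries identity: a controlled selection between two prepared
ancilla states has a weighted sum as its block. -/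
theorem emb_conjTranspose_mul_blockDiagonal_mul_emb [DecidableEq C] (w v : C → ℂ) (F : C → Matrix E E ℂ) :
    (emb E w)ᴴ * blockDiagonal F * emb E v = ∑ c, (star (w c) * v c) • F c := by
  ext x y
  simp only [emb, Matrix.mul_apply, conjTranspose_apply, of_apply, blockDiagonal_apply,
    Fintype.sum_prod_type, Matrix.sum_apply, Matrix.smul_apply, smul_eq_mul, Finset.sum_mul]
  simp only [apply_ite star, star_zero, ite_mul, zero_mul, mul_ite, mul_zero]
  rw [Finset.sum_comm]
  simp [mul_right_comm]

theorem kronecker_mul_emb (B : Matrix C C ℂ) (v : C → ℂ) :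
    ((1 : Matrix E E ℂ) ⊗ₖ B) * emb E v = emb E (B *ᵥ v) := by
  ext ⟨x, c⟩ y
  simp only [emb, Matrix.mul_apply, kroneckerMap_apply, of_apply, Fintype.sum_prod_type,
    Matrix.one_apply, mulVec, dotProduct, ite_mul, one_mul, zero_mul, mul_ite, mul_zero]
  rw [Finset.sum_comm]
  simp

theorem emb_conjTranspose_mul_emb [DecidableEq C] (w v : C → ℂ) :
    (emb E w)ᴴ * emb E v = (∑ c, star (w c) * v c) • (1 : Matrix E E ℂ) := by
  have := emb_conjTranspose_mul_blockDiagonal_mul_emb (E := E) w v (fun _ => 1)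
  rw [show blockDiagonal (fun _ : C => (1 : Matrix E E ℂ)) = 1 from blockDiagonal_one] at this
  rw [Matrix.mul_one] at this
  rw [this, Finset.sum_smul]

theorem emb_mul_conjTranspose {E C : Type*} [Fintype E] [DecidableEq E] (v w : C → ℂ) :
    emb E v * (emb E w)ᴴ = (1 : Matrix E E ℂ) ⊗ₖ vecMulVec v (star w) := by
  ext ⟨x, c⟩ ⟨y, d⟩
  rcases eq_or_ne x y with rfl | h
  · simp [emb, Matrix.mul_apply, kroneckerMap_apply, vecMulVec_apply]
  · simp [emb, Matrix.mul_apply, kroneckerMap_apply, vecMulVec_apply, h, h.symm]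

end Emb

/-! ### Oblivious amplitude amplification -/

section Amplification
variable {X E : Type*} [Fintype X] [DecidableEq X] [Fintype E] [DecidableEq E]

theorem norm_one_matrix_le : ‖(1 : Matrix X X ℂ)‖ ≤ 1 := by
  rw [← diagonal_one, l2_opNorm_diagonal]
  exact (pi_norm_le_iff_of_nonneg zero_le_one).2 fun _ => by simp

theorem norm_le_one_of_isometry {X : Type*} [Fintype X] {T : Matrix X E ℂ} (h : Tᴴ * T = 1) : ‖T‖ ≤ 1 := by
  have h1 := l2_opNorm_conjTranspose_mul_self T
  rw [h] at h1
  have h2 := norm_one_matrix_le (X := E)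
  nlinarith [norm_nonneg T]

/-- One round of oblivious amplitude amplification for a block encoding with amplitude `1 / 2`. -/
def amplify (T : Matrix X E ℂ) (V : Matrix X X ℂ) : Matrix X X ℂ :=
  V * (1 - (2 : ℂ) • (T * Tᴴ)) * Vᴴ * ((2 : ℂ) • (T * Tᴴ) - 1) * V

/-- An exact error formula. Both terms vanish when twice the block equals an isometry `U`; this is
the amplification of the amplitude `1/2 = sin(π/6)` to `sin(3π/6) = 1`. -/
theorem amplify_mul_sub {T : Matrix X E ℂ} {V : Matrix X X ℂ} (hT : Tᴴ * T = 1) (hV : Vᴴ * V = 1)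
    (hV' : V * Vᴴ = 1) (U : Matrix E E ℂ) :
    amplify T V * T - T * U =
      V * T * (1 - ((2 : ℂ) • (Tᴴ * V * T))ᴴ * ((2 : ℂ) • (Tᴴ * V * T))) +
        T * ((2 : ℂ) • (Tᴴ * V * T) - U) := by
  set a := Tᴴ * V * T with ha
  have h1 : ((2 : ℂ) • (T * Tᴴ) - 1) * V * T = (2 : ℂ) • (T * a) - V * T := by
    simp only [ha, Matrix.sub_mul, Matrix.one_mul, Matrix.smul_mul, Matrix.mul_assoc]
  have ha' : aᴴ = Tᴴ * Vᴴ * T := by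
    simp [ha, conjTranspose_mul, Matrix.mul_assoc]
  have h2 : Vᴴ * (((2 : ℂ) • (T * Tᴴ) - 1) * V * T) = (2 : ℂ) • (Vᴴ * T * a) - T := by
    rw [h1, Matrix.mul_sub, ← Matrix.mul_assoc Vᴴ V T, hV, Matrix.one_mul, Matrix.mul_smul,
      Matrix.mul_assoc]
  have h3 : (1 - (2 : ℂ) • (T * Tᴴ)) * (Vᴴ * (((2 : ℂ) • (T * Tᴴ) - 1) * V * T)) =
      (2 : ℂ) • (Vᴴ * T * a) + T - (4 : ℂ) • (T * (aᴴ * a)) := by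
    have e1 : T * Tᴴ * (Vᴴ * T * a) = T * (aᴴ * a) := by
      rw [ha']; simp only [Matrix.mul_assoc]
    have e2 : T * Tᴴ * T = T := by rw [Matrix.mul_assoc, hT, Matrix.mul_one]
    rw [h2, Matrix.sub_mul, Matrix.one_mul, Matrix.smul_mul, Matrix.mul_sub, Matrix.mul_smul, e1, e2]
    module
  have h4 : amplify T V * T = V * ((2 : ℂ) • (Vᴴ * T * a) + T - (4 : ℂ) • (T * (aᴴ * a))) := by
    rw [← h3]
    simp only [amplify, Matrix.mul_assoc]
  have e3 : V * (Vᴴ * T * a) = T * a := by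
    rw [Matrix.mul_assoc Vᴴ, ← Matrix.mul_assoc V, hV', Matrix.one_mul]
  rw [h4, Matrix.mul_sub, Matrix.mul_add, Matrix.mul_smul, Matrix.mul_smul, e3]
  simp only [conjTranspose_smul, Matrix.mul_sub, Matrix.smul_mul, Matrix.mul_smul, Matrix.mul_one,
    Matrix.mul_assoc, smul_smul]
  norm_num
  module

theorem norm_amplify_mul_sub_le {T : Matrix X E ℂ} {V : Matrix X X ℂ} {U : Matrix E E ℂ} {δ : ℝ}
    (hT : Tᴴ * T = 1) (hV : Vᴴ * V = 1) (hV' : V * Vᴴ = 1) (hU : Uᴴ * U = 1)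
    (hδ : ‖(2 : ℂ) • (Tᴴ * V * T) - U‖ ≤ δ) (hδ1 : δ ≤ 1) :
    ‖amplify T V * T - T * U‖ ≤ 4 * δ := by
  rw [amplify_mul_sub hT hV hV' U]
  set Y := (2 : ℂ) • (Tᴴ * V * T) with hY
  have nT := norm_le_one_of_isometry hT
  have nV := norm_le_one_of_isometry hV
  have nU := norm_le_one_of_isometry hU
  have hδ0 : 0 ≤ δ := (norm_nonneg _).trans hδ
  have nY : ‖Y‖ ≤ 1 + δ := by
    calc ‖Y‖ = ‖U + (Y - U)‖ := by congr 1; abel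
      _ ≤ _ := (norm_add_le _ _).trans (add_le_add nU hδ)
  -- Replacing 1 by `Uᴴ * U` makes the defect of `Y` from isometry first order in `Y - U`.
  have e : 1 - Yᴴ * Y = -(Uᴴ * (Y - U) + (Y - U)ᴴ * Y) := by
    rw [← hU, conjTranspose_sub, Matrix.sub_mul, Matrix.mul_sub]
    abel
  have n1 : ‖1 - Yᴴ * Y‖ ≤ δ + δ * (1 + δ) := by
    rw [e, norm_neg]
    refine (norm_add_le _ _).trans (add_le_add ?_ ?_)
    · refine (l2_opNorm_mul _ _).trans ?_
      rw [l2_opNorm_conjTranspose]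
      calc ‖U‖ * ‖Y - U‖ ≤ 1 * δ := by gcongr
        _ = δ := one_mul _
    · refine (l2_opNorm_mul _ _).trans ?_
      rw [l2_opNorm_conjTranspose]
      gcongr
  have nVT : ‖V * T‖ ≤ 1 := by
    refine (l2_opNorm_mul _ _).trans ?_
    calc ‖V‖ * ‖T‖ ≤ 1 * 1 := by gcongr
      _ = 1 := one_mul _
  calc ‖V * T * (1 - Yᴴ * Y) + T * (Y - U)‖
      ≤ ‖V * T‖ * ‖1 - Yᴴ * Y‖ + ‖T‖ * ‖Y - U‖ :=
        (norm_add_le _ _).trans (add_le_add (l2_opNorm_mul _ _) (l2_opNorm_mul _ _))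
    _ ≤ 1 * (δ + δ * (1 + δ)) + 1 * δ := by gcongr
    _ ≤ 4 * δ := by nlinarith

/-- Telescoping: the remaining factors are contractions, so errors of successive segments only add.
-/
theorem norm_pow_mul_sub_le {T : Matrix X E ℂ} {G : Matrix X X ℂ} {U : Matrix E E ℂ} {η : ℝ}
    (hG : ‖G‖ ≤ 1) (hU : ‖U‖ ≤ 1) (h : ‖G * T - T * U‖ ≤ η) (r : ℕ) :
    ‖G ^ r * T - T * U ^ r‖ ≤ r * η := by
  induction r with
  | zero => simp
  | succ r ih =>
    have e : G ^ (r + 1) * T - T * U ^ (r + 1) =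
        G * (G ^ r * T - T * U ^ r) + (G * T - T * U) * U ^ r := by
      rw [pow_succ' G, pow_succ' U, Matrix.mul_sub, Matrix.sub_mul]
      simp only [Matrix.mul_assoc]
      abel
    have hUr : ‖U ^ r‖ ≤ 1 := by
      rcases Nat.eq_zero_or_pos r with rfl | hr
      · simpa using norm_one_matrix_le
      · exact (norm_pow_le' U hr).trans (pow_le_one₀ (norm_nonneg _) hU)
    have hη : 0 ≤ η := (norm_nonneg _).trans h
    rw [e]
    calc _ ≤ ‖G‖ * ‖G ^ r * T - T * U ^ r‖ + ‖G * T - T * U‖ * ‖U ^ r‖ :=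
          (norm_add_le _ _).trans (add_le_add (l2_opNorm_mul _ _) (l2_opNorm_mul _ _))
      _ ≤ 1 * (r * η) + η * 1 := by gcongr
      _ = ((r + 1 : ℕ) : ℝ) * η := by push_cast; ring

end Amplification

end

/-! ### Products of single-qubit operators -/

instance : Fintype Pauli := ⟨{.I, .X, .Y, .Z}, fun p => by cases p <;> simp⟩

theorem card_pauli : Fintype.card Pauli = 4 := rfl

/-- The operator `A_1 ⊗ ⋯ ⊗ A_n`. -/
def prodOp {n : ℕ} (A : Fin n → Matrix (Fin 2) (Fin 2) ℂ) : Op n :=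
  Matrix.of fun x y => ∏ i, A i (x i) (y i)

theorem prodOp_mul {n : ℕ} (A B : Fin n → Matrix (Fin 2) (Fin 2) ℂ) :
    prodOp A * prodOp B = prodOp (fun i => A i * B i) := by
  ext x y
  simp only [prodOp, Matrix.mul_apply, of_apply, ← Finset.prod_mul_distrib]
  rw [Finset.prod_univ_sum]
  simp

theorem prodOp_one {n : ℕ} : prodOp (fun _ : Fin n => 1) = 1 := by
  ext x y
  simp only [prodOp, of_apply, Matrix.one_apply]
  rw [Fintype.prod_ite_zero]
  simp [funext_iff]

theorem pauliOp_eq_prodOp {n : ℕ} (P : Fin n → Pauli) :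
    pauliOp P = prodOp (fun i => (P i).mat) := rfl

theorem prodOp_smul {n : ℕ} (c : Fin n → ℂ) (A : Fin n → Matrix (Fin 2) (Fin 2) ℂ) :
    prodOp (fun i => c i • A i) = (∏ i, c i) • prodOp A := by
  ext x y
  simp [prodOp, Finset.prod_mul_distrib]

theorem Pauli.exists_mat_mul (p q : Pauli) :
    ∃ (c : ℂ) (r : Pauli), ‖c‖ = 1 ∧ p.mat * q.mat = c • r.mat ∧ (p = .I → q = .I → r = .I) := by
  cases p <;> cases q
  · exact ⟨1, .I, by simp [Pauli.mat]⟩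
  · exact ⟨1, .X, by simp [Pauli.mat]⟩
  · exact ⟨1, .Y, by simp [Pauli.mat]⟩
  · exact ⟨1, .Z, by simp [Pauli.mat]⟩
  · exact ⟨1, .X, by simp [Pauli.mat]⟩
  · exact ⟨1, .I, by simp [Pauli.mat, Matrix.one_fin_two]⟩
  · exact ⟨Complex.I, .Z, by simp [Pauli.mat]⟩
  · exact ⟨-Complex.I, .Y, by simp [Pauli.mat]⟩
  · exact ⟨1, .Y, by simp [Pauli.mat]⟩
  · exact ⟨-Complex.I, .Z, by simp [Pauli.mat]⟩
  · exact ⟨1, .I, by simp [Pauli.mat, Matrix.one_fin_two]⟩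
  · exact ⟨Complex.I, .X, by simp [Pauli.mat]⟩
  · exact ⟨1, .Z, by simp [Pauli.mat]⟩
  · exact ⟨Complex.I, .Y, by simp [Pauli.mat]⟩
  · exact ⟨-Complex.I, .X, by simp [Pauli.mat]⟩
  · exact ⟨1, .I, by simp [Pauli.mat, Matrix.one_fin_two]⟩

theorem Pauli.mat_mul_self (p : Pauli) : p.mat * p.mat = 1 := by
  cases p <;> simp [Pauli.mat, Matrix.one_fin_two]

theorem Pauli.star_mat_apply (p : Pauli) (a b : Fin 2) : star (p.mat a b) = p.mat b a := by
  cases p <;> fin_cases a <;> fin_cases b <;> simp [Pauli.mat]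

theorem pauliOp_mul_self {n : ℕ} (P : Fin n → Pauli) : pauliOp P * pauliOp P = 1 := by
  rw [pauliOp_eq_prodOp, prodOp_mul, ← prodOp_one]
  simp only [Pauli.mat_mul_self]

theorem pauliOp_conjTranspose {n : ℕ} (P : Fin n → Pauli) : (pauliOp P)ᴴ = pauliOp P := by
  ext x y
  simp only [pauliOp, conjTranspose_apply, of_apply, star_prod, Pauli.star_mat_apply]

theorem pauliOp_const_I {n : ℕ} : pauliOp (fun _ : Fin n => Pauli.I) = 1 := by
  rw [pauliOp_eq_prodOp, ← prodOp_one]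
  rfl

/-! ### The spin form of a transposition -/

theorem pauliOp_update_mul {n : ℕ} (p : Pauli) {i j : Fin n} (hij : i ≠ j) :
    pauliOp (Function.update (fun _ => Pauli.I) i p) *
      pauliOp (Function.update (fun _ => Pauli.I) j p) =
    pauliOp (fun l => if l = i ∨ l = j then p else Pauli.I) := by
  rw [pauliOp_eq_prodOp, pauliOp_eq_prodOp, prodOp_mul, pauliOp_eq_prodOp]
  congr 1
  ext1 l
  by_cases h1 : l = i
  · subst h1
    simp [hij, Pauli.mat]
  · by_cases h2 : l = j
    · subst h2
      simp [h1, Pauli.mat]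
    · simp [h1, h2, Pauli.mat]

theorem pauliOp_pair_apply {n : ℕ} (p : Pauli) {i j : Fin n} (hij : i ≠ j) (x y : Qubits n) :
    pauliOp (fun l => if l = i ∨ l = j then p else Pauli.I) x y =
      if ∀ l, l ≠ i → l ≠ j → x l = y l then p.mat (x i) (y i) * p.mat (x j) (y j) else 0 := by
  have hji : j ∈ Finset.univ.erase i := Finset.mem_erase.2 ⟨hij.symm, Finset.mem_univ j⟩
  simp only [pauliOp, of_apply]
  rw [← Finset.mul_prod_erase _ _ (Finset.mem_univ i), ← Finset.mul_prod_erase _ _ hji, ← mul_assoc]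
  have hrest : ∏ l ∈ (Finset.univ.erase i).erase j,
      (if l = i ∨ l = j then p else Pauli.I).mat (x l) (y l) =
      if ∀ l, l ≠ i → l ≠ j → x l = y l then 1 else 0 := by
    rw [Finset.prod_congr rfl (g := fun l => if x l = y l then (1 : ℂ) else 0)]
    · rw [Finset.prod_ite_zero]
      simp only [Finset.prod_const_one, Finset.mem_erase, Finset.mem_univ, and_true]
      congr 1
      exact propext ⟨fun h l h1 h2 => h l ⟨h2, h1⟩, fun h l hl => h l hl.2 hl.1⟩
    · intro l hl
      simp only [Finset.mem_erase, Finset.mem_univ, and_true] at hl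
      simp [hl.1, hl.2, Pauli.mat, Matrix.one_apply]
  rw [hrest]
  simp

theorem permRep_swap_apply {n : ℕ} {i j : Fin n} (hij : i ≠ j) (x y : Qubits n) :
    permRep n (Equiv.swap i j) x y =
      if ∀ l, l ≠ i → l ≠ j → x l = y l then (if x i = y j ∧ x j = y i then 1 else 0) else 0 := by
  simp only [permRep, MonoidHom.coe_mk, OneHom.coe_mk, of_apply, Equiv.swap_inv]
  rw [← ite_and]
  congr 1
  refine propext ⟨?_, ?_⟩
  · rintro rfl
    refine ⟨fun l h1 h2 => ?_, ?_, ?_⟩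
    · simp [Equiv.swap_apply_of_ne_of_ne h1 h2]
    · simp
    · simp
  · rintro ⟨h1, h2, h3⟩
    ext1 l
    by_cases hi : l = i
    · subst hi; simpa using h2
    · by_cases hj : l = j
      · subst hj; simpa using h3
      · simpa [Equiv.swap_apply_of_ne_of_ne hi hj] using h1 l hi hj

/-- The identity is written as a degenerate pair operator so that all four terms share one entry
formula; what remains is a check of 4 × 4 matrices. -/
theorem permRep_swap_eq_pauliOp {n : ℕ} {i j : Fin n} (hij : i ≠ j) :
    permRep n (Equiv.swap i j) =
      (1 / 2 : ℂ) • (pauliOp (fun l => if l = i ∨ l = j then Pauli.I else Pauli.I) +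
        pauliOp (fun l => if l = i ∨ l = j then Pauli.X else Pauli.I) +
        pauliOp (fun l => if l = i ∨ l = j then Pauli.Y else Pauli.I) +
        pauliOp (fun l => if l = i ∨ l = j then Pauli.Z else Pauli.I)) := by
  ext x y
  simp only [Matrix.smul_apply, Matrix.add_apply, permRep_swap_apply hij, pauliOp_pair_apply _ hij]
  split_ifs with h1 h2
  · generalize x i = a, x j = b, y i = c, y j = d at *
    obtain ⟨rfl, rfl⟩ := h2
    fin_cases a <;> fin_cases b <;> norm_num [Pauli.mat]
  · generalize x i = a, x j = b, y i = c, y j = d at *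
    fin_cases a <;> fin_cases b <;> fin_cases c <;> fin_cases d <;>
      simp [Pauli.mat] at h2 ⊢
  · simp

theorem permRep_swap {n : ℕ} {i j : Fin n} (hij : i ≠ j) :
    permRep n (Equiv.swap i j) = (2 : ℂ) • spinDot i j + (1 / 2 : ℂ) • (1 : Op n) := by
  rw [permRep_swap_eq_pauliOp hij]
  simp only [spinDot, spin, smul_mul_smul_comm, pauliOp_update_mul _ hij, ite_self,
    pauliOp_const_I]
  module

/-! ### Pauli expansion of the permutation representation -/

/-- The Pauli operators acting trivially outside `S`. -/
def pauliOn {n : ℕ} (S : Finset (Fin n)) (P : {P : Fin n → Pauli // ∀ i ∉ S, P i = .I}) : Op n :=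
  pauliOp P.1

/-- The Pauli operators of weight at most `k`. -/
def pauliLe (n k : ℕ) (P : {P : Fin n → Pauli // pauliWeight P ≤ k}) : Op n :=
  pauliOp P.1

theorem absComb_pauliOn_mul {n : ℕ} {S : Finset (Fin n)}
    (P Q : {P : Fin n → Pauli // ∀ i ∉ S, P i = .I}) :
    AbsComb (pauliOn S) 1 (pauliOn S P * pauliOn S Q) := by
  choose c r hc hr hI using Pauli.exists_mat_mul
  have h : pauliOn S P * pauliOn S Q = (∏ i, c (P.1 i) (Q.1 i)) •
      pauliOn S ⟨fun i => r (P.1 i) (Q.1 i), fun i hi => hI _ _ (P.2 i hi) (Q.2 i hi)⟩ := by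
    simp only [pauliOn, pauliOp_eq_prodOp, prodOp_mul, hr]
    exact prodOp_smul _ _
  rw [h]
  refine ((AbsComb.of_index _ _).smul _).mono ?_
  simp [norm_prod, hc]

theorem absComb_permRep_swap {n : ℕ} {S : Finset (Fin n)} {i j : Fin n} (hij : i ≠ j)
    (hi : i ∈ S) (hj : j ∈ S) : AbsComb (pauliOn S) 2 (permRep n (Equiv.swap i j)) := by
  have hp (p : Pauli) :
      AbsComb (pauliOn S) 1 (pauliOp (fun l => if l = i ∨ l = j then p else Pauli.I)) :=
    AbsComb.of_index (pauliOn S) ⟨fun l => if l = i ∨ l = j then p else Pauli.I, fun l hl =>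
      if_neg (by rintro (rfl | rfl) <;> contradiction)⟩
  rw [permRep_swap_eq_pauliOp hij]
  refine (((((hp _).add (hp _)).add (hp _)).add (hp _)).smul _).mono ?_
  norm_num

/-- Splitting off the transposition `(x σ(x))` lowers the number of moved points, and a permutation
moving one point at most is trivial, so `m + 1` moved points cost `m` factors of 2. The set `S` is
fixed because Paulis supported in `S` are closed under products up to phases, while a bound on the
weight alone is not preserved. -/
theorem absComb_permRep {n : ℕ} (S : Finset (Fin n)) (m : ℕ) (σ : Equiv.Perm (Fin n))
    (hS : σ.support ⊆ S) (hm : σ.support.card ≤ m + 1) :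
    AbsComb (pauliOn S) (2 ^ m) (permRep n σ) := by
  by_cases h1 : σ = 1
  · have h := AbsComb.of_index (pauliOn S) ⟨fun _ => Pauli.I, fun _ _ => rfl⟩
    rw [pauliOn, pauliOp_const_I] at h
    rw [h1, map_one]
    exact h.mono (one_le_pow₀ (by norm_num))
  induction m generalizing σ with
  | zero => exact absurd (Equiv.Perm.two_le_card_support_of_ne_one h1) (by omega)
  | succ m ih =>
    obtain ⟨x, hx⟩ : ∃ x, σ x ≠ x := by
      by_contra! h
      exact h1 (Equiv.ext h)
    set τ := Equiv.swap x (σ x) * σ with hτ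
    have hσ : σ = Equiv.swap x (σ x) * τ := by simp [hτ, ← mul_assoc]
    have hcard : τ.support.card < σ.support.card := Equiv.Perm.card_support_swap_mul hx
    have hτS : τ.support ⊆ S := fun y hy =>
      hS (Equiv.Perm.mem_support_swap_mul_imp_mem_support_ne hy).1
    have hτc : AbsComb (pauliOn S) (2 ^ m) (permRep n τ) := by
      by_cases h2 : τ = 1
      · have h := AbsComb.of_index (pauliOn S) ⟨fun _ => Pauli.I, fun _ _ => rfl⟩
        rw [pauliOn, pauliOp_const_I] at h
        rw [h2, map_one]
        exact h.mono (one_le_pow₀ (by norm_num))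
      · exact ih τ hτS (by omega) h2
    have hxS : x ∈ S := hS (Equiv.Perm.mem_support.2 hx)
    have hσxS : σ x ∈ S := hS (Equiv.Perm.mem_support.2 fun h => hx (σ.injective h))
    have hmul : permRep n σ = permRep n (Equiv.swap x (σ x)) * permRep n τ := by
      rw [← map_mul, ← hσ]
    rw [hmul, pow_succ']
    exact (absComb_permRep_swap hx.symm hxS hσxS).mul hτc absComb_pauliOn_mul

/-- Enlarge the support to a set `A` of exactly `min k n` points and list the values of `σ` along
`A` in increasing order. Since `σ` preserves `A`, the list determines `A` as its set of values, and
hence `σ`. -/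
theorem card_perm_support_le {n : ℕ} (hn : 1 ≤ n) (k : ℕ) :
    (Finset.univ.filter fun σ : Equiv.Perm (Fin n) => σ.support.card ≤ k).card ≤ n ^ k := by
  set m := min k n with hm
  have hex : ∀ σ : {σ : Equiv.Perm (Fin n) // σ.support.card ≤ k},
      ∃ A : Finset (Fin n), σ.1.support ⊆ A ∧ A.card = m := fun σ =>
    Finset.exists_superset_card_eq
      (le_min σ.2 ((Finset.card_le_univ _).trans (by simp))) (by simp [hm])
  choose A hA hcard using hex
  have himage : ∀ σ : {σ : Equiv.Perm (Fin n) // σ.support.card ≤ k}, (A σ).image σ.1 = A σ := by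
    intro σ
    refine Finset.eq_of_subset_of_card_le (fun y hy => ?_)
      (by rw [Finset.card_image_of_injective _ σ.1.injective])
    obtain ⟨x, hx, rfl⟩ := Finset.mem_image.1 hy
    by_cases h : σ.1 x = x
    · rwa [h]
    · exact hA σ (Equiv.Perm.mem_support.2 fun h' => h (σ.1.injective h'))
  let F : {σ : Equiv.Perm (Fin n) // σ.support.card ≤ k} → (Fin m → Fin n) := fun σ s =>
    σ.1 ((A σ).orderEmbOfFin (hcard σ) s)
  have hF : Function.Injective F := by
    intro σ τ h
    have hrange : ∀ ρ, Finset.univ.image (F ρ) = A ρ := by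
      intro ρ
      conv_rhs => rw [← himage ρ, ← Finset.image_orderEmbOfFin_univ (A ρ) (hcard ρ)]
      rw [Finset.image_image]
      rfl
    have hAA : A σ = A τ := by rw [← hrange, ← hrange, h]
    have hemb : ∀ (B D : Finset (Fin n)) (hB : B.card = m) (hD : D.card = m), B = D →
        B.orderEmbOfFin hB = D.orderEmbOfFin hD := by
      rintro B _ hB hD rfl
      rfl
    ext1
    ext1 x
    by_cases hx : x ∈ A σ
    · rw [← Finset.image_orderEmbOfFin_univ (A σ) (hcard σ)] at hx
      obtain ⟨s, -, rfl⟩ := Finset.mem_image.1 hx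
      have h1 := congrFun h s
      simp only [F] at h1
      rwa [hemb _ _ (hcard τ) (hcard σ) hAA.symm] at h1
    · have h1 := Equiv.Perm.notMem_support.1 fun h => hx (hA σ h)
      have h2 := Equiv.Perm.notMem_support.1 fun h => hx (hAA ▸ hA τ h)
      rw [h1, h2]
  have h := Fintype.card_le_of_injective F hF
  rw [Fintype.card_subtype] at h
  refine h.trans ?_
  simp only [Fintype.card_pi, Fintype.card_fin, Finset.prod_const, Finset.card_univ]
  exact Nat.pow_le_pow_right hn (min_le_left _ _)

/-- A Pauli string is encoded by `k` positions covering its support, repetitions allowed, together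
with the labels found there. -/
theorem card_pauliWeight_le {n : ℕ} (hn : 1 ≤ n) (k : ℕ) :
    Fintype.card {P : Fin n → Pauli // pauliWeight P ≤ k} ≤ (4 * n) ^ k := by
  have hex : ∀ P : {P : Fin n → Pauli // pauliWeight P ≤ k},
      ∃ g : Fin k → Fin n, ∀ i, P.1 i ≠ .I → ∃ s, g s = i := by
    intro P
    set A := Finset.univ.filter fun i => P.1 i ≠ Pauli.I with hA
    have hAk : A.card ≤ k := P.2
    refine ⟨fun s => if h : s.1 < A.card then A.orderEmbOfFin rfl ⟨s.1, h⟩ else ⟨0, hn⟩,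
      fun i hi => ?_⟩
    have hiA : i ∈ A := by simpa [hA] using hi
    rw [← Finset.image_orderEmbOfFin_univ A rfl] at hiA
    obtain ⟨s, -, rfl⟩ := Finset.mem_image.1 hiA
    exact ⟨⟨s.1, s.2.trans_le hAk⟩, by simp⟩
  choose g hg using hex
  let F : {P : Fin n → Pauli // pauliWeight P ≤ k} → (Fin k → Pauli × Fin n) := fun P s =>
    (P.1 (g P s), g P s)
  have hF : Function.Injective F := by
    intro P Q h
    have hg' : g P = g Q := funext fun s => congrArg Prod.snd (congrFun h s)
    ext1
    ext1 i
    by_cases hi : ∃ s, g P s = i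
    · obtain ⟨s, rfl⟩ := hi
      have h1 : P.1 (g P s) = Q.1 (g Q s) := congrArg Prod.fst (congrFun h s)
      rw [h1, hg']
    · have h1 : P.1 i = .I := by
        by_contra h
        exact hi (hg P i h)
      have h2 : Q.1 i = .I := by
        by_contra h
        exact hi (hg' ▸ hg Q i h)
      rw [h1, h2]
  have h := Fintype.card_le_of_injective F hF
  simpa [card_pauli] using h

/-! ### Pauli expansion of a local Hamiltonian -/

theorem algRep_eq_sum {n : ℕ} (f : GroupAlg n) :
    algRep n f = ∑ σ, f.coeff σ • permRep n σ := by
  rw [algRep, MonoidAlgebra.lift_apply, Finsupp.sum_fintype]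
  simp

theorem absComb_algRep {n k : ℕ} (hn : 1 ≤ n) {f : GroupAlg n} (hk : 1 ≤ k) (hf : IsLocal k f) :
    AbsComb (pauliLe n k) (lConst k f * (n : ℝ) ^ k) (algRep n f) := by
  rw [algRep_eq_sum]
  have h : ∀ σ ∈ Finset.univ, AbsComb (pauliLe n k)
      (if σ.support.card ≤ k then lConst k f else 0) (f.coeff σ • permRep n σ) := by
    intro σ _
    by_cases h0 : f.coeff σ = 0
    · rw [h0, zero_smul]
      refine (AbsComb.zero _).mono ?_
      split_ifs
      · exact mul_nonneg ((norm_nonneg _).trans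
          (Finset.le_sup' (fun σ => ‖f.coeff σ‖) (Finset.mem_univ 1))) (by positivity)
      · exact le_rfl
    · have hσ := hf σ h0
      rw [if_pos hσ]
      have h1 := absComb_permRep σ.support (k - 1) σ subset_rfl (by omega)
      have h2 : AbsComb (pauliLe n k) (2 ^ (k - 1)) (permRep n σ) := by
        refine h1.subst fun P => ?_
        have hP : pauliWeight P.1 ≤ k := by
          refine (Finset.card_le_card fun i hi => ?_).trans hσ
          by_contra hi'
          exact (Finset.mem_filter.1 hi).2 (P.2 i hi')
        exact AbsComb.of_index (pauliLe n k) ⟨P.1, hP⟩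
      refine (h2.smul _).mono ?_
      rw [lConst]
      gcongr
      exact Finset.le_sup' (fun σ => ‖f.coeff σ‖) (Finset.mem_univ σ)
  refine (AbsComb.sum h).mono ?_
  rw [← Finset.sum_filter, Finset.sum_const, nsmul_eq_mul, mul_comm]
  have hL : 0 ≤ lConst k f := mul_nonneg ((norm_nonneg _).trans
    (Finset.le_sup' (fun σ => ‖f.coeff σ‖) (Finset.mem_univ 1))) (by positivity)
  gcongr
  exact_mod_cast card_perm_support_le hn k

/-- Averaging the expansion with its adjoint replaces each coefficient by its real part, so linear
independence of the Paulis plays no role. -/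
theorem exists_real_pauli_expansion {n k : ℕ} {H : Op n} {s : ℝ} (hH : H.IsHermitian)
    (h : AbsComb (pauliLe n k) s H) :
    ∃ b : {P : Fin n → Pauli // pauliWeight P ≤ k} → ℝ,
      ∑ P, |b P| ≤ s ∧ H = ∑ P, (b P : ℂ) • pauliOp P.1 := by
  obtain ⟨b, hb, hHb⟩ := h
  refine ⟨fun P => (b P).re, (Finset.sum_le_sum fun P _ => Complex.abs_re_le_norm _).trans hb, ?_⟩
  have h1 : H = (1 / 2 : ℂ) • (H + Hᴴ) := by
    rw [hH.eq]
    module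
  have h2 : Hᴴ = ∑ P, star (b P) • pauliOp P.1 := by
    rw [hHb, conjTranspose_sum]
    simp only [conjTranspose_smul, pauliLe, pauliOp_conjTranspose]
  rw [h1, h2]
  conv_lhs => rw [hHb]
  rw [← Finset.sum_add_distrib, Finset.smul_sum]
  refine Finset.sum_congr rfl fun P _ => ?_
  rw [pauliLe, ← add_smul, smul_smul]
  congr 1
  rw [Complex.re_eq_add_conj]
  simp only [starRingEnd_apply]
  ring

/-! ### Preparing ancilla states -/

/-- A unit vector extends to an orthonormal basis with `u` at the index `c₀`. -/
theorem exists_unitary_mulVec {C : Type*} [Fintype C] [DecidableEq C] (u : C → ℂ)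
    (hu : ∑ c, star (u c) * u c = 1) (c₀ : C) :
    ∃ B ∈ unitaryGroup C ℂ, B *ᵥ Pi.single c₀ 1 = u := by
  have hnorm : ‖(WithLp.toLp 2 u : EuclideanSpace ℂ C)‖ = 1 := by
    have h : ((‖(WithLp.toLp 2 u : EuclideanSpace ℂ C)‖ ^ 2 : ℝ) : ℂ) = 1 := by
      rw [EuclideanSpace.norm_sq_eq, ← hu]
      push_cast
      exact Finset.sum_congr rfl fun c _ => by
        rw [← Complex.conj_mul']
        rfl
    have h' : ‖(WithLp.toLp 2 u : EuclideanSpace ℂ C)‖ ^ 2 = 1 := by exact_mod_cast h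
    exact (pow_eq_one_iff_of_nonneg (norm_nonneg _) two_ne_zero).1 h'
  obtain ⟨b, hb⟩ := Orthonormal.exists_orthonormalBasis_extension_of_card_eq (𝕜 := ℂ)
    (E := EuclideanSpace ℂ C) (ι := C) (by simp) (v := fun _ => WithLp.toLp 2 u) (s := {c₀})
    ⟨fun i => by simpa using hnorm, fun i j hij => absurd (Subsingleton.elim i j) hij⟩
  refine ⟨_, (EuclideanSpace.basisFun C ℂ).toMatrix_orthonormalBasis_mem_unitary b, ?_⟩
  ext1 c
  simp [Module.Basis.toMatrix_apply, hb c₀ rfl]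

/-- Coefficients of `ℓ¹`-norm at most one are products of the amplitudes of two states. -/
theorem exists_amplitudes {K : Type*} [Fintype K] [DecidableEq K] {b : K → ℂ}
    (hb : ∑ i, ‖b i‖ ≤ 1) {k₀ k₁ : K} (hk : k₀ ≠ k₁) :
    ∃ u w : Fin 2 × K → ℂ, ∑ c, star (u c) * u c = 1 ∧ ∑ c, star (w c) * w c = 1 ∧
      (∀ i, star (w (0, i)) * u (0, i) = b i) ∧ ∀ i, star (w (1, i)) * u (1, i) = 0 := by
  set s : ℝ := Real.sqrt (1 - ∑ i, ‖b i‖) with hs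
  have hss : (s : ℂ) * s = 1 - ∑ i, (‖b i‖ : ℂ) := by
    rw [← Complex.ofReal_mul, hs, Real.mul_self_sqrt (by linarith)]
    push_cast
    rfl
  have hq (i : K) : (Real.sqrt ‖b i‖ : ℂ) * Real.sqrt ‖b i‖ = ‖b i‖ := by
    rw [← Complex.ofReal_mul, Real.mul_self_sqrt (norm_nonneg _)]
  -- The flag value 1 holds the missing weight `1 - ∑ ‖b i‖`, at `k₀` in `u` and at `k₁` in `w`, so
  -- it normalises both states without contributing to the products. At `b i = 0` the quotient is 0
  -- by convention.
  refine ⟨fun c => if c.1 = 0 then b c.2 / Real.sqrt ‖b c.2‖ else if c.2 = k₀ then (s : ℂ) else 0,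
    fun c => if c.1 = 0 then (Real.sqrt ‖b c.2‖ : ℂ) else if c.2 = k₁ then (s : ℂ) else 0,
    ?_, ?_, fun i => ?_, fun i => ?_⟩
  · rw [Fintype.sum_prod_type, Fin.sum_univ_two]
    have h1 (i : K) : star (b i / (Real.sqrt ‖b i‖ : ℂ)) * (b i / (Real.sqrt ‖b i‖ : ℂ)) = ‖b i‖ := by
      by_cases h0 : b i = 0
      · simp [h0]
      · have h2 : (‖b i‖ : ℂ) ≠ 0 := by simpa using h0
        have h3 : star (b i) * b i = (‖b i‖ : ℂ) ^ 2 := Complex.conj_mul' _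
        rw [star_div₀, div_mul_div_comm, h3, Complex.star_def, Complex.conj_ofReal, hq]
        field_simp
    simp only [if_true, h1]
    simp [apply_ite star, hss]
  · rw [Fintype.sum_prod_type, Fin.sum_univ_two]
    simp [apply_ite star, hss, hq]
  · by_cases h0 : b i = 0
    · simp [h0]
    · have h2 : (Real.sqrt ‖b i‖ : ℂ) ≠ 0 := by
        simpa using h0
      simp only [if_true, Complex.star_def, Complex.conj_ofReal]
      field_simp
  · by_cases h : i = k₀
    · subst h
      simp [hk]
    · simp [h]

/-! ### Operators implemented with Pauli gates -/

/-- `Impl n k D c U`: the operator `U` is a product of unitaries on the ancilla register `D` and of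
`c` Pauli gates of weight at most `k`. -/
inductive Impl (n k : ℕ) (D : Type) [Fintype D] [DecidableEq D] :
    ℕ → Matrix (Qubits n × D) (Qubits n × D) ℂ → Prop
  | one : Impl n k D 0 1
  | ancilla {c : ℕ} {U : Matrix (Qubits n × D) (Qubits n × D) ℂ} (B : Matrix D D ℂ)
      (hB : B ∈ unitaryGroup D ℂ) (hU : Impl n k D c U) : Impl n k D c (((1 : Op n) ⊗ₖ B) * U)
  | pauli {c : ℕ} {U : Matrix (Qubits n × D) (Qubits n × D) ℂ} (P : D → Fin n → Pauli)
      (hP : ∀ d, pauliWeight (P d) ≤ k) (hU : Impl n k D c U) :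
      Impl n k D (c + 1) ((blockDiagonal fun d => pauliOp (P d)) * U)

namespace Impl

variable {n k : ℕ} {D : Type} [Fintype D] [DecidableEq D] {c c' : ℕ}
  {U U' : Matrix (Qubits n × D) (Qubits n × D) ℂ}

theorem mul (h : Impl n k D c U) (h' : Impl n k D c' U') : Impl n k D (c + c') (U * U') := by
  induction h with
  | one => simpa using h'
  | ancilla B hB _ ih => simpa only [Matrix.mul_assoc] using ih.ancilla B hB
  | pauli P hP _ ih =>
    rw [add_right_comm]
    simpa only [Matrix.mul_assoc] using ih.pauli P hP

theorem of_ancilla {B : Matrix D D ℂ} (hB : B ∈ unitaryGroup D ℂ) :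
    Impl n k D 0 ((1 : Op n) ⊗ₖ B) := by
  simpa using Impl.one.ancilla (n := n) (k := k) B hB

theorem of_pauli {P : D → Fin n → Pauli} (hP : ∀ d, pauliWeight (P d) ≤ k) :
    Impl n k D 1 (blockDiagonal fun d => pauliOp (P d)) := by
  simpa using Impl.one.pauli (n := n) (k := k) P hP

theorem pow (h : Impl n k D c U) (r : ℕ) : Impl n k D (r * c) (U ^ r) := by
  induction r with
  | zero => simpa using Impl.one
  | succ r ih =>
    rw [pow_succ, Nat.succ_mul]
    exact ih.mul h

theorem conjTranspose (h : Impl n k D c U) : Impl n k D c Uᴴ := by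
  induction h with
  | one => simpa using Impl.one
  | ancilla B hB _ ih =>
    rw [conjTranspose_mul, conjTranspose_kronecker, conjTranspose_one]
    exact ih.mul (of_ancilla (Unitary.star_mem hB))
  | pauli P hP _ ih =>
    rw [conjTranspose_mul, blockDiagonal_conjTranspose]
    simp only [pauliOp_conjTranspose]
    exact ih.mul (of_pauli hP)

theorem conjTranspose_mul_self (h : Impl n k D c U) : Uᴴ * U = 1 := by
  induction h with
  | one => simp
  | @ancilla c U B hB _ ih =>
    have hB' : Bᴴ * B = 1 := mem_unitaryGroup_iff'.1 hB
    rw [conjTranspose_mul, Matrix.mul_assoc, ← Matrix.mul_assoc _ _ U, conjTranspose_kronecker,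
      ← mul_kronecker_mul, hB', conjTranspose_one, Matrix.one_mul, one_kronecker_one,
      Matrix.one_mul, ih]
  | @pauli c U P hP _ ih =>
    rw [conjTranspose_mul, Matrix.mul_assoc, ← Matrix.mul_assoc _ _ U, blockDiagonal_conjTranspose,
      ← blockDiagonal_mul]
    simp only [pauliOp_conjTranspose, pauliOp_mul_self]
    rw [show (fun _ : D => (1 : Op n)) = 1 from rfl, blockDiagonal_one, Matrix.one_mul, ih]

theorem mul_conjTranspose_self (h : Impl n k D c U) : U * Uᴴ = 1 :=
  mul_eq_one_comm.1 h.conjTranspose_mul_self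

end Impl

/-! ### Adjoining a further ancilla register and controlling by it -/

section Extension

variable {n k : ℕ} {D C : Type} [Fintype D] [DecidableEq D] [Fintype C] [DecidableEq C]

/-- `Impl` for operators on `(system ⊗ D) ⊗ C`. -/
def ImplExt (n k : ℕ) (D C : Type) [Fintype D] [DecidableEq D] [Fintype C] [DecidableEq C] (c : ℕ)
    (M : Matrix ((Qubits n × D) × C) ((Qubits n × D) × C) ℂ) : Prop :=
  Impl n k (D × C) c (reindexAlgEquiv ℂ ℂ (Equiv.prodAssoc (Qubits n) D C) M)

variable {c c' : ℕ} {M M' : Matrix ((Qubits n × D) × C) ((Qubits n × D) × C) ℂ}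

theorem ImplExt.one : ImplExt n k D C 0 1 := by
  rw [ImplExt, map_one]
  exact Impl.one

theorem ImplExt.mul (h : ImplExt n k D C c M) (h' : ImplExt n k D C c' M') :
    ImplExt n k D C (c + c') (M * M') := by
  rw [ImplExt, map_mul]
  exact Impl.mul h h'

theorem ImplExt.pow (h : ImplExt n k D C c M) (r : ℕ) : ImplExt n k D C (r * c) (M ^ r) := by
  rw [ImplExt, map_pow]
  exact Impl.pow h r

theorem ImplExt.conjTranspose (h : ImplExt n k D C c M) : ImplExt n k D C c Mᴴ := by
  rw [ImplExt, coe_reindexAlgEquiv, ← conjTranspose_reindex]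
  exact Impl.conjTranspose h

theorem ImplExt.conjTranspose_mul_self (h : ImplExt n k D C c M) : Mᴴ * M = 1 := by
  have h1 := Impl.conjTranspose_mul_self h
  rw [coe_reindexAlgEquiv, conjTranspose_reindex, ← coe_reindexAlgEquiv ℂ, ← map_mul,
    map_eq_one_iff _ (AlgEquiv.injective _)] at h1
  exact h1

theorem ImplExt.mul_conjTranspose_self (h : ImplExt n k D C c M) : M * Mᴴ = 1 :=
  mul_eq_one_comm.1 h.conjTranspose_mul_self

theorem ImplExt.of_ancilla {B : Matrix C C ℂ} (hB : B ∈ unitaryGroup C ℂ) :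
    ImplExt n k D C 0 ((1 : Matrix (Qubits n × D) (Qubits n × D) ℂ) ⊗ₖ B) := by
  rw [ImplExt, ← one_kronecker_one, coe_reindexAlgEquiv, kronecker_assoc]
  refine Impl.of_ancilla (mem_unitaryGroup_iff'.2 ?_)
  have hB' : Bᴴ * B = 1 := mem_unitaryGroup_iff'.1 hB
  rw [star_eq_conjTranspose, conjTranspose_kronecker, ← mul_kronecker_mul, hB', conjTranspose_one,
    Matrix.one_mul, one_kronecker_one]

/-- Controlling an implementable operator by the register `C` costs nothing. -/
theorem Impl.controlled {U : Matrix (Qubits n × D) (Qubits n × D) ℂ} (h : Impl n k D c U)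
    (q : C → Prop) [DecidablePred q] :
    ImplExt n k D C c (blockDiagonal fun x => if q x then U else 1) := by
  induction h with
  | one =>
    simp only [ite_self]
    rw [show (fun _ : C => (1 : Matrix (Qubits n × D) (Qubits n × D) ℂ)) = 1 from rfl,
      blockDiagonal_one]
    exact ImplExt.one
  | @ancilla c U B hB _ ih =>
    have e : (blockDiagonal fun x => if q x then ((1 : Op n) ⊗ₖ B) * U else 1) =
        (blockDiagonal fun x => if q x then (1 : Op n) ⊗ₖ B else 1) *
          blockDiagonal fun x => if q x then U else 1 := by
      rw [← blockDiagonal_mul]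
      congr 1
      ext1 x
      split_ifs <;> simp
    have hBq : (blockDiagonal fun x : C => if q x then B else 1) ∈ unitaryGroup (D × C) ℂ := by
      have hB' : Bᴴ * B = 1 := mem_unitaryGroup_iff'.1 hB
      rw [mem_unitaryGroup_iff', star_eq_conjTranspose, blockDiagonal_conjTranspose,
        ← blockDiagonal_mul, ← blockDiagonal_one]
      congr 1
      ext1 x
      split_ifs <;> simp [hB']
    rw [e, ImplExt, map_mul]
    convert Impl.ancilla _ hBq ih using 1
    refine congrArg (· * _) ?_
    ext ⟨x, d, y⟩ ⟨x', d', y'⟩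
    by_cases hy : y = y'
    · subst hy
      by_cases hq : q y <;> by_cases hx : x = x' <;>
        simp [blockDiagonal_apply, hq, hx, kroneckerMap_apply, Matrix.one_apply]
    · simp [blockDiagonal_apply, hy, kroneckerMap_apply]
  | @pauli c U P hP _ ih =>
    have e : (blockDiagonal fun x => if q x then (blockDiagonal fun d => pauliOp (P d)) * U else 1) =
        (blockDiagonal fun x => if q x then blockDiagonal fun d => pauliOp (P d) else 1) *
          blockDiagonal fun x => if q x then U else 1 := by
      rw [← blockDiagonal_mul]
      congr 1
      ext1 x
      split_ifs <;> simp
    rw [e, ImplExt, map_mul]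
    -- Where the control is off, the gate selects the identity string, which has weight 0; it is
    -- still a single Pauli gate.
    have hP' : ∀ d : D × C, pauliWeight (if q d.2 then P d.1 else fun _ => Pauli.I) ≤ k := by
      intro d
      split_ifs
      · exact hP _
      · simp [pauliWeight]
    convert Impl.pauli _ hP' ih using 1
    · refine congrArg (· * _) ?_
      ext ⟨x, d, y⟩ ⟨x', d', y'⟩
      by_cases hy : y = y'
      · subst hy
        by_cases hq : q y <;> by_cases hd : d = d' <;>
          simp [blockDiagonal_apply, hq, hd, pauliOp_const_I, Matrix.one_apply]
      · simp [blockDiagonal_apply, hy]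

/-- The power is built from `m` controlled copies of `U`, the copy with index `s` being active
exactly when `s < e x`. -/
theorem Impl.controlled_pow {U : Matrix (Qubits n × D) (Qubits n × D) ℂ} (h : Impl n k D c U)
    (e : C → ℕ) {m : ℕ} (hm : ∀ x, e x ≤ m) :
    ImplExt n k D C (m * c) (blockDiagonal fun x => U ^ e x) := by
  have key : ∀ s : ℕ, ImplExt n k D C (s * c) (blockDiagonal fun x => U ^ min (e x) s) := by
    intro s
    induction s with
    | zero =>
      simp only [min_zero, pow_zero, zero_mul]
      rw [show (fun _ : C => (1 : Matrix (Qubits n × D) (Qubits n × D) ℂ)) = 1 from rfl,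
        blockDiagonal_one]
      exact ImplExt.one
    | succ s ih =>
      have e1 : (blockDiagonal fun x => U ^ min (e x) (s + 1)) =
          (blockDiagonal fun x => U ^ min (e x) s) *
            blockDiagonal fun x => if s < e x then U else 1 := by
        rw [← blockDiagonal_mul]
        congr 1
        ext1 x
        split_ifs with hs
        · rw [min_eq_right (by omega), min_eq_right (by omega), pow_succ]
        · rw [min_eq_left (by omega), min_eq_left (by omega), Matrix.mul_one]
      rw [e1, Nat.succ_mul]
      exact ih.mul (h.controlled _)
  convert key m using 3 with x
  rw [min_eq_left (hm x)]

theorem Impl.uncontrolled {U : Matrix (Qubits n × D) (Qubits n × D) ℂ} (h : Impl n k D c U) :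
    ImplExt n k D C c (blockDiagonal fun _ => U) := by
  simpa using h.controlled (C := C) fun _ => True

end Extension

/-- Implementable operators are realised by circuits. -/
theorem Impl.exists_circuit {n k a : ℕ} {D : Type} [Fintype D] [DecidableEq D] {c : ℕ}
    {U : Matrix (Qubits n × D) (Qubits n × D) ℂ} (h : Impl n k D c U) (e : Qubits a ≃ D) :
    ∃ W : Circuit n k a, pauliCount W = c ∧
      circuitOp W = U.submatrix (Prod.map id e) (Prod.map id e) := by
  induction h with
  | one =>
    refine ⟨[], rfl, ?_⟩
    rw [submatrix_one _ (Function.injective_id.prodMap e.injective)]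
    rfl
  | @ancilla c U B hB _ ih =>
    obtain ⟨W, hW, hWU⟩ := ih
    have hB' : B.submatrix e e ∈ unitaryGroup (Qubits a) ℂ := by
      rw [mem_unitaryGroup_iff', star_eq_conjTranspose, conjTranspose_submatrix,
        submatrix_mul_equiv, ← star_eq_conjTranspose, mem_unitaryGroup_iff'.1 hB, submatrix_one_equiv]
    refine ⟨Gate.ancilla ⟨_, hB'⟩ :: W, ?_, ?_⟩
    · simpa [pauliCount, Gate.cost] using hW
    · have h1 : circuitOp (Gate.ancilla ⟨_, hB'⟩ :: W) =
          ((1 : Op n) ⊗ₖ (B.submatrix e e)) * circuitOp W := by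
        simp [circuitOp, Gate.op]
      rw [h1, hWU, submatrix_mul _ _ _ _ _ (Function.bijective_id.prodMap e.bijective)]
      rfl
  | @pauli c U P hP _ ih =>
    obtain ⟨W, hW, hWU⟩ := ih
    refine ⟨Gate.pauli (fun j => P (e j)) (fun j => hP _) :: W, ?_, ?_⟩
    · simp only [pauliCount, List.map_cons, Gate.cost, List.sum_cons] at hW ⊢
      omega
    · have h1 : circuitOp (Gate.pauli (fun j => P (e j)) (fun j => hP _) :: W) =
          (blockDiagonal fun j => pauliOp (P (e j))) * circuitOp W := by
        simp [circuitOp, Gate.op]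
      rw [h1, hWU, submatrix_mul _ _ _ _ _ (Function.bijective_id.prodMap e.bijective)]
      congr 1
      ext ⟨x, d⟩ ⟨y, d'⟩
      simp [blockDiagonal_apply]

/-! ### Reflections about an ancilla basis state -/

section

open scoped Matrix.Norms.L2Operator Nat

theorem emb_single_isometry {E C : Type*} [Fintype E] [DecidableEq E] [Fintype C] [DecidableEq C]
    (c₀ : C) : (emb E (Pi.single c₀ 1 : C → ℂ))ᴴ * emb E (Pi.single c₀ 1 : C → ℂ) = 1 := by
  rw [emb_conjTranspose_mul_emb, Finset.sum_eq_single c₀] <;> simp +contextual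

theorem reflection_mem_unitaryGroup {C : Type*} [Fintype C] [DecidableEq C] (c₀ : C) :
    (2 : ℂ) • vecMulVec (Pi.single c₀ 1) (star (Pi.single c₀ 1)) - 1 ∈ unitaryGroup C ℂ := by
  have h : (2 : ℂ) • vecMulVec (Pi.single c₀ 1) (star (Pi.single c₀ 1)) - 1 =
      diagonal fun c => if c = c₀ then (1 : ℂ) else -1 := by
    ext i j
    simp only [Matrix.sub_apply, Matrix.smul_apply, vecMulVec_apply, Pi.star_apply,
      Pi.single_apply, diagonal_apply, Matrix.one_apply]
    by_cases hi : i = c₀ <;> by_cases hj : j = c₀ <;> by_cases hij : i = j <;>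
      simp_all
    norm_num
  rw [h, mem_unitaryGroup_iff', star_eq_conjTranspose, diagonal_conjTranspose, diagonal_mul_diagonal,
    ← diagonal_one]
  congr 1
  ext1 c
  by_cases hc : c = c₀ <;> simp [hc]

theorem neg_mem_unitaryGroup {C : Type*} [Fintype C] [DecidableEq C] {B : Matrix C C ℂ}
    (hB : B ∈ unitaryGroup C ℂ) : -B ∈ unitaryGroup C ℂ := by
  rw [mem_unitaryGroup_iff', star_neg, neg_mul_neg]
  exact mem_unitaryGroup_iff'.1 hB

/-! ### Block encoding of a local Hamiltonian -/

/-- The flag carries the sign of the coefficient. The missing weight is spread equally over both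
signs, so it cancels in the difference while a single state serves on both sides. -/
theorem exists_signed_amplitudes {K : Type*} [Fintype K] [Nonempty K] {b : K → ℝ}
    (hb : ∑ i, |b i| ≤ 1) :
    ∃ u : Fin 2 × K → ℂ, ∑ c, star (u c) * u c = 1 ∧
      ∀ i, star (u (0, i)) * u (0, i) - star (u (1, i)) * u (1, i) = b i := by
  set p : ℝ := (1 - ∑ i, |b i|) / Fintype.card K with hp
  have hcard : (0 : ℝ) < Fintype.card K := by exact_mod_cast Fintype.card_pos
  have hp0 : 0 ≤ p := div_nonneg (by linarith) hcard.le
  set a : Fin 2 × K → ℝ := fun c => (|b c.2| + p + if c.1 = 0 then b c.2 else -b c.2) / 2 with ha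
  have ha0 (c) : 0 ≤ a c := by
    simp only [ha]
    have h1 := neg_abs_le (b c.2)
    have h2 := le_abs_self (b c.2)
    split_ifs <;> linarith
  have hu (c) : star (Real.sqrt (a c) : ℂ) * (Real.sqrt (a c) : ℂ) = a c := by
    rw [Complex.star_def, Complex.conj_ofReal, ← Complex.ofReal_mul, Real.mul_self_sqrt (ha0 c)]
  refine ⟨fun c => Real.sqrt (a c), ?_, fun i => ?_⟩
  · simp only [hu]
    rw [← Complex.ofReal_sum, Fintype.sum_prod_type, Fin.sum_univ_two, ← Finset.sum_add_distrib]
    have h1 (i : K) : a (0, i) + a (1, i) = |b i| + p := by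
      simp [ha]
      ring
    simp only [h1, Finset.sum_add_distrib, Finset.sum_const, Finset.card_univ, nsmul_eq_mul]
    rw [hp, mul_div_cancel₀ _ hcard.ne']
    simp
  · simp only [hu]
    rw [← Complex.ofReal_sub]
    congr 1
    simp [ha]
    ring

/-- The same preparation unitary is used on both sides of a signed Pauli selection, which keeps `S`
self-adjoint, as the walk operator requires. The signs are a diagonal ancilla unitary and cost
nothing. -/
theorem exists_block_encoding {n k : ℕ} {K : Type} [Fintype K] [DecidableEq K] [Nonempty K]
    (b : K → ℝ) (P : K → Fin n → Pauli) (hP : ∀ i, pauliWeight (P i) ≤ k) (hb : ∑ i, |b i| ≤ 1)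
    (c₀ : Fin 2 × K) :
    ∃ S : Matrix (Qubits n × (Fin 2 × K)) (Qubits n × (Fin 2 × K)) ℂ,
      Impl n k (Fin 2 × K) 1 S ∧ Sᴴ = S ∧
      (emb (Qubits n) (Pi.single c₀ 1))ᴴ * S * emb (Qubits n) (Pi.single c₀ 1) =
        ∑ i, (b i : ℂ) • pauliOp (P i) := by
  obtain ⟨u, hu, hub⟩ := exists_signed_amplitudes hb
  obtain ⟨B, hB, hBu⟩ := exists_unitary_mulVec u hu c₀
  set sgn : Fin 2 × K → ℂ := fun c => if c.1 = 0 then 1 else -1 with hsgn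
  have hsgn1 (c) : star (sgn c) = sgn c := by
    simp only [hsgn]
    split_ifs <;> simp
  have hD : diagonal sgn ∈ unitaryGroup (Fin 2 × K) ℂ := by
    rw [mem_unitaryGroup_iff', star_eq_conjTranspose, diagonal_conjTranspose,
      diagonal_mul_diagonal, ← diagonal_one]
    congr 1
    ext1 c
    simp only [Pi.star_apply, hsgn1]
    simp only [hsgn]
    split_ifs <;> simp
  set S₀ : Matrix (Qubits n × (Fin 2 × K)) (Qubits n × (Fin 2 × K)) ℂ :=
    blockDiagonal fun c => sgn c • pauliOp (P c.2) with hS₀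
  have hS₀' : S₀ = (blockDiagonal fun c => pauliOp (P c.2)) * ((1 : Op n) ⊗ₖ diagonal sgn) := by
    rw [kronecker_diagonal, ← blockDiagonal_mul, hS₀]
    congr 1
    ext1 c
    rw [op_smul_eq_smul, Matrix.mul_smul, Matrix.mul_one]
  have hS₀H : S₀ᴴ = S₀ := by
    rw [hS₀, blockDiagonal_conjTranspose]
    simp only [conjTranspose_smul, pauliOp_conjTranspose, hsgn1]
  have hS₀i : Impl n k (Fin 2 × K) 1 S₀ := by
    rw [hS₀']
    have h1 : Impl n k (Fin 2 × K) 1 (blockDiagonal fun c => pauliOp (P c.2)) :=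
      Impl.of_pauli (P := fun c : Fin 2 × K => P c.2) fun c => hP c.2
    have h2 : Impl n k (Fin 2 × K) 0 ((1 : Op n) ⊗ₖ diagonal sgn) := Impl.of_ancilla hD
    exact h1.mul h2
  have hBi : Impl n k (Fin 2 × K) 0 ((1 : Op n) ⊗ₖ B) := Impl.of_ancilla hB
  have hBT : ((1 : Op n) ⊗ₖ B) * emb (Qubits n) (Pi.single c₀ 1) = emb (Qubits n) u := by
    rw [kronecker_mul_emb, hBu]
  have hSu : (emb (Qubits n) u)ᴴ * S₀ * emb (Qubits n) u = ∑ i, (b i : ℂ) • pauliOp (P i) := by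
    rw [hS₀, emb_conjTranspose_mul_blockDiagonal_mul_emb, Fintype.sum_prod_type,
      Fin.sum_univ_two, ← Finset.sum_add_distrib]
    refine Finset.sum_congr rfl fun i _ => ?_
    rw [← hub i]
    simp only [hsgn, smul_smul, if_true, one_ne_zero, if_false]
    module
  generalize (1 : Op n) ⊗ₖ B = M at hBi hBT
  clear_value S₀
  refine ⟨Mᴴ * S₀ * M, ?_, ?_, ?_⟩
  · have h := (hBi.conjTranspose.mul hS₀i).mul hBi
    rwa [zero_add, add_zero] at h
  · rw [conjTranspose_mul, conjTranspose_mul, conjTranspose_conjTranspose, hS₀H, Matrix.mul_assoc]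
  · rw [← hSu, ← hBT, conjTranspose_mul]
    simp only [Matrix.mul_assoc]

/-! ### The walk operator -/

/-- Qubitization: on the range of the isometry, the Hermitian part of the walk operator acts as the
block-encoded Hamiltonian. -/
theorem exists_walk {n k : ℕ} {D : Type} [Fintype D] [DecidableEq D] {c : ℕ}
    {S : Matrix (Qubits n × D) (Qubits n × D) ℂ} (hS : Impl n k D c S) (hSH : Sᴴ = S) {H : Op n}
    {d₀ : D}
    (hH : (emb (Qubits n) (Pi.single d₀ 1))ᴴ * S * emb (Qubits n) (Pi.single d₀ 1) = H) :
    ∃ W : Matrix (Qubits n × D) (Qubits n × D) ℂ, Impl n k D c W ∧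
      ((1 / 2 : ℂ) • (W + Wᴴ)) * emb (Qubits n) (Pi.single d₀ 1) =
        emb (Qubits n) (Pi.single d₀ 1) * H := by
  set T := emb (Qubits n) (Pi.single d₀ 1 : D → ℂ) with hT
  have hTT : Tᴴ * T = 1 := emb_single_isometry d₀
  set B : Matrix D D ℂ := (2 : ℂ) • vecMulVec (Pi.single d₀ 1) (star (Pi.single d₀ 1)) - 1 with hB
  have hBu : B ∈ unitaryGroup D ℂ := reflection_mem_unitaryGroup d₀
  have hR : (1 : Op n) ⊗ₖ B = (2 : ℂ) • (T * Tᴴ) - 1 := by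
    rw [hT, emb_mul_conjTranspose, hB, ← one_kronecker_one, sub_eq_add_neg, kronecker_add,
      kronecker_smul, ← neg_one_smul ℂ (1 : Matrix D D ℂ), kronecker_smul, neg_one_smul,
      ← sub_eq_add_neg]
  refine ⟨((1 : Op n) ⊗ₖ B) * S, by simpa only [zero_add] using (Impl.of_ancilla hBu).mul hS, ?_⟩
  have hRH : ((2 : ℂ) • (T * Tᴴ) - 1)ᴴ = (2 : ℂ) • (T * Tᴴ) - 1 := by
    rw [conjTranspose_sub, conjTranspose_smul, conjTranspose_mul, conjTranspose_conjTranspose,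
      conjTranspose_one]
    simp
  have hRT : ((2 : ℂ) • (T * Tᴴ) - 1) * T = T := by
    rw [Matrix.sub_mul, Matrix.smul_mul, Matrix.mul_assoc, hTT, Matrix.mul_one, Matrix.one_mul]
    module
  -- With `R = 2TTᴴ - 1` and `RT = T`, one has `(RS + SR)T = 2TTᴴST - ST + ST`: the part leaving the
  -- range of `T` cancels.
  rw [hR, conjTranspose_mul, hSH, hRH, Matrix.smul_mul, Matrix.add_mul, Matrix.mul_assoc S, hRT,
    Matrix.mul_assoc, Matrix.sub_mul, Matrix.one_mul, Matrix.smul_mul, sub_add_cancel, smul_smul,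
    ← hH]
  simp only [Matrix.mul_assoc]
  norm_num

/-- Each factor `½(W + W')` moves the exponent by ±1 with total weight 1, so `j` factors reach only
the exponents `l - j` to `l + j`. Starting at `l ≥ j` keeps them nonnegative. -/
theorem absComb_walk_powers {A : Type*} [Ring A] [Algebra ℂ A] {W W' : A} (hW : W * W' = 1)
    {m : ℕ} (j : ℕ) :
    ∀ l, j ≤ l → l + j < m →
      AbsComb (fun i : Fin m => W ^ (i : ℕ)) 1 (W ^ l * ((1 / 2 : ℂ) • (W + W')) ^ j) := by
  induction j with
  | zero =>
    intro l _ hl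
    rw [pow_zero, mul_one]
    exact AbsComb.of_index (fun i : Fin m => W ^ (i : ℕ)) ⟨l, hl⟩
  | succ j ih =>
    intro l hjl hl
    obtain ⟨l, rfl⟩ : ∃ l', l = l' + 1 := ⟨l - 1, by omega⟩
    set Q := (1 / 2 : ℂ) • (W + W') with hQ
    have e : W ^ (l + 1) * Q ^ (j + 1) = (1 / 2 : ℂ) • (W ^ (l + 2) * Q ^ j + W ^ l * Q ^ j) := by
      have e1 : W ^ (l + 1) * Q = (1 / 2 : ℂ) • (W ^ (l + 2) + W ^ l) := by
        rw [hQ, mul_smul_comm, mul_add, ← pow_succ, pow_succ W l, mul_assoc, hW, mul_one]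
      rw [pow_succ' Q, ← mul_assoc, e1, smul_mul_assoc, add_mul]
    rw [e]
    refine (((ih _ (by omega) (by omega)).add (ih _ (by omega) (by omega))).smul _).mono ?_
    norm_num

/-! ### One segment of the simulation -/

/-- The Taylor polynomial `Z` is multiplied by `W ^ N` to have only exponents from 0 to `2 * N - 1`;
the selection then applies `(Wᴴ) ^ N` to undo the shift. This costs `(N + m) * c` gates, and
amplification uses the block encoding three times. -/
theorem exists_segment {n k c : ℕ} {D K : Type} [Fintype D] [DecidableEq D] [Fintype K]
    [DecidableEq K] {W : Matrix (Qubits n × D) (Qubits n × D) ℂ} (hW : Impl n k D c W) {N m : ℕ}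
    (hN : 0 < N) (hm : 2 * N ≤ m) (e : K ≃ Fin m) {θ : ℝ} (hθ : 0 ≤ θ) (hθ' : θ ≤ 1 / 2)
    (hNf : 2 / (N ! : ℝ) ≤ 1) (x₀ : Fin 2 × K) :
    ∃ G : Matrix ((Qubits n × D) × (Fin 2 × K)) ((Qubits n × D) × (Fin 2 × K)) ℂ,
      ImplExt n k D (Fin 2 × K) (3 * (N + m) * c) G ∧
      ‖G * emb (Qubits n × D) (Pi.single x₀ 1) - emb (Qubits n × D) (Pi.single x₀ 1) *
        NormedSpace.exp ((-(Complex.I * θ)) • ((1 / 2 : ℂ) • (W + Wᴴ)))‖ ≤ 8 / (N ! : ℝ) := by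
  obtain ⟨x₁, x₂, hx⟩ : ∃ x₁ x₂ : K, x₁ ≠ x₂ :=
    ⟨e.symm ⟨0, by omega⟩, e.symm ⟨1, by omega⟩, fun h => by simpa using e.symm.injective h⟩
  set T := emb (Qubits n × D) (Pi.single x₀ 1 : Fin 2 × K → ℂ) with hT
  have hTT : Tᴴ * T = 1 := emb_single_isometry x₀
  have hWW := hW.mul_conjTranspose_self
  have hWW' := hW.conjTranspose_mul_self
  set Q := (1 / 2 : ℂ) • (W + Wᴴ) with hQ
  set Y := (-(Complex.I * θ)) • Q with hY
  have hQH : Qᴴ = Q := by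
    rw [hQ, conjTranspose_smul, conjTranspose_add, conjTranspose_conjTranspose, add_comm]
    simp
  have nW : ‖W‖ ≤ 1 := norm_le_one_of_isometry hWW'
  have nQ : ‖Q‖ ≤ 1 := by
    rw [hQ, norm_smul]
    have h1 := norm_add_le W Wᴴ
    rw [l2_opNorm_conjTranspose] at h1
    norm_num
    linarith
  have nθ : ‖-(Complex.I * θ)‖ = θ := by simp [abs_of_nonneg hθ]
  have nY : ‖Y‖ ≤ 1 := by
    rw [hY, norm_smul, nθ]
    nlinarith [norm_nonneg Q]
  set U := NormedSpace.exp Y with hU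
  have hYH : Yᴴ = -Y := by
    rw [hY, conjTranspose_smul, hQH]
    simp
  have hUU : Uᴴ * U = 1 := by
    rw [hU, ← exp_conjTranspose, hYH, ← Matrix.exp_add_of_commute _ _ (Commute.refl Y).neg_left,
      neg_add_cancel, NormedSpace.exp_zero]
  set Z := ∑ j ∈ Finset.range N, ((j ! : ℂ)⁻¹) • Y ^ j with hZ
  have hZU : ‖U - Z‖ ≤ 2 / (N ! : ℝ) := norm_exp_sub_sum_le Y nY hN
  have hcomb : AbsComb (fun i : K => W ^ (e i : ℕ)) 1 ((1 / 2 : ℂ) • (W ^ N * Z)) := by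
    have h1 : AbsComb (fun i : Fin m => W ^ (i : ℕ)) (∑ j ∈ Finset.range N, θ ^ j / (j ! : ℝ))
        (W ^ N * Z) := by
      rw [hZ, Finset.mul_sum]
      refine AbsComb.sum fun j hj => ?_
      have hj' := Finset.mem_range.1 hj
      rw [hY, smul_pow, smul_smul, Matrix.mul_smul]
      refine ((absComb_walk_powers hWW j N (by omega) (by omega)).smul _).mono (le_of_eq ?_)
      rw [norm_mul, norm_pow, nθ]
      simp [div_eq_inv_mul]
    -- The bound `exp θ ≤ 1 / (1 - θ) ≤ 2` is where `θ ≤ 1/2` enters; it allows the block to be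
    -- exactly `Z / 2`, the amplitude that one round of amplification needs.
    have h2 : ∑ j ∈ Finset.range N, θ ^ j / (j ! : ℝ) ≤ 2 := by
      refine (Real.sum_le_exp_of_nonneg hθ N).trans ?_
      have := Real.exp_bound_div_one_sub_of_interval hθ (by linarith)
      refine this.trans ?_
      rw [div_le_iff₀ (by linarith)]
      linarith
    refine ((h1.mono h2).smul (1 / 2)).subst (fun i => ?_) |>.mono (by norm_num)
    simpa using AbsComb.of_index (fun i : K => W ^ (e i : ℕ)) (e.symm i)
  obtain ⟨b, hb, hbZ⟩ := hcomb
  obtain ⟨u, w, hu, hw, h0, h1⟩ := exists_amplitudes hb hx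
  obtain ⟨Bu, hBu, hBu'⟩ := exists_unitary_mulVec u hu x₀
  obtain ⟨Bw, hBw, hBw'⟩ := exists_unitary_mulVec w hw x₀
  set F := blockDiagonal fun x : Fin 2 × K => (Wᴴ) ^ N * W ^ (e x.2 : ℕ) with hF
  have hFi : ImplExt n k D (Fin 2 × K) ((N + m) * c) F := by
    have h2 : F = (blockDiagonal fun _ => (Wᴴ) ^ N) *
        blockDiagonal fun x : Fin 2 × K => W ^ (e x.2 : ℕ) := by
      rw [hF, blockDiagonal_mul]
    rw [h2, add_mul]
    exact (hW.conjTranspose.pow N).uncontrolled.mul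
      (hW.controlled_pow (fun x : Fin 2 × K => (e x.2 : ℕ)) fun x => (e x.2).2.le)
  have hBwi : ImplExt n k D (Fin 2 × K) 0
      ((1 : Matrix (Qubits n × D) (Qubits n × D) ℂ) ⊗ₖ Bw) := ImplExt.of_ancilla hBw
  have hBui : ImplExt n k D (Fin 2 × K) 0
      ((1 : Matrix (Qubits n × D) (Qubits n × D) ℂ) ⊗ₖ Bu) := ImplExt.of_ancilla hBu
  have hMw : ((1 : Matrix (Qubits n × D) (Qubits n × D) ℂ) ⊗ₖ Bw) * T =
      emb (Qubits n × D) w := by rw [hT, kronecker_mul_emb, hBw']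
  have hMu : ((1 : Matrix (Qubits n × D) (Qubits n × D) ℂ) ⊗ₖ Bu) * T =
      emb (Qubits n × D) u := by rw [hT, kronecker_mul_emb, hBu']
  generalize (1 : Matrix (Qubits n × D) (Qubits n × D) ℂ) ⊗ₖ Bw = Mw at hBwi hMw
  generalize (1 : Matrix (Qubits n × D) (Qubits n × D) ℂ) ⊗ₖ Bu = Mu at hBui hMu
  have hV : ImplExt n k D (Fin 2 × K) ((N + m) * c) (Mwᴴ * F * Mu) := by
    simpa only [zero_add, add_zero] using (hBwi.conjTranspose.mul hFi).mul hBui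
  have hblock : Tᴴ * (Mwᴴ * F * Mu) * T = (1 / 2 : ℂ) • Z := by
    have e1 : Tᴴ * (Mwᴴ * F * Mu) * T = (Mw * T)ᴴ * F * (Mu * T) := by
      rw [conjTranspose_mul]
      clear_value F T
      simp only [Matrix.mul_assoc]
    rw [e1, hMw, hMu, hF, emb_conjTranspose_mul_blockDiagonal_mul_emb, Fintype.sum_prod_type,
      Fin.sum_univ_two]
    simp only [h0, h1, zero_smul, Finset.sum_const_zero, add_zero]
    have e2 : ∑ i, b i • ((Wᴴ) ^ N * W ^ (e i : ℕ)) = (Wᴴ) ^ N * ∑ i, b i • W ^ (e i : ℕ) := by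
      rw [Finset.mul_sum]
      exact Finset.sum_congr rfl fun i _ => (Matrix.mul_smul _ _ _).symm
    rw [e2, ← hbZ, Matrix.mul_smul, ← Matrix.mul_assoc]
    have e3 : (Wᴴ) ^ N * W ^ N = 1 := by
      rw [← (show Commute Wᴴ W from hWW'.trans hWW.symm).mul_pow, hWW', one_pow]
    rw [e3, Matrix.one_mul]
  refine ⟨amplify T (Mwᴴ * F * Mu), ?_, ?_⟩
  · have hr : ImplExt n k D (Fin 2 × K) 0 ((2 : ℂ) • (T * Tᴴ) - 1) := by
      have h2 := ImplExt.of_ancilla (n := n) (k := k) (D := D) (reflection_mem_unitaryGroup x₀)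
      convert h2 using 1
      rw [hT, emb_mul_conjTranspose, sub_eq_add_neg, sub_eq_add_neg, kronecker_add,
        kronecker_smul, ← neg_one_smul ℂ (1 : Matrix (Fin 2 × K) (Fin 2 × K) ℂ), kronecker_smul,
        one_kronecker_one, neg_one_smul]
    have hr' : ImplExt n k D (Fin 2 × K) 0 (1 - (2 : ℂ) • (T * Tᴴ)) := by
      have h2 := ImplExt.of_ancilla (n := n) (k := k) (D := D)
        (neg_mem_unitaryGroup (reflection_mem_unitaryGroup x₀))
      convert h2 using 1
      rw [hT, emb_mul_conjTranspose, neg_sub, sub_eq_add_neg, sub_eq_add_neg, kronecker_add,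
        ← neg_smul, ← neg_smul, kronecker_smul, one_kronecker_one]
    have h2 := (((hV.mul hr').mul hV.conjTranspose).mul hr).mul hV
    convert h2 using 1
    · ring
    · rfl
  · have h2 := norm_amplify_mul_sub_le (δ := 2 / (N ! : ℝ)) hTT hV.conjTranspose_mul_self
      hV.mul_conjTranspose_self hUU ?_ hNf
    · refine h2.trans (le_of_eq ?_)
      ring
    · rw [hblock, smul_smul, norm_sub_rev]
      norm_num
      exact hZU

end

section

open scoped Matrix.Norms.L2Operator Nat

/-! ### Choice of the parameters -/

theorem one_le_logRatio {x : ℝ} (hx : Real.exp 1 < x) : 1 ≤ logRatio x := by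
  have hy : 1 < Real.log x := (Real.lt_log_iff_exp_lt ((Real.exp_pos 1).trans hx)).2 hx
  rw [logRatio, le_div_iff₀ (Real.log_pos hy), one_mul]
  linarith [Real.log_le_sub_one_of_pos (zero_lt_one.trans hy)]

/-- With `y = log x` and `N ≥ 12 y / log y`, the inequality `z ^ N / N! ≤ exp z` at `z = √y` gives
`N! ≥ exp (6y - √y) ≥ exp (5y) = exp (4y) * x`. The factor 24 matches the total error `r * 8 / N!`
with `r ≤ 3τ`, where `τ = tL(k)n^k` and `x = τ/ε`. -/
theorem exists_truncation_order {x : ℝ} (hx : Real.exp 1 < x) :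
    ∃ N : ℕ, 0 < N ∧ (N : ℝ) ≤ 13 * logRatio x ∧ 24 * x ≤ (N ! : ℝ) := by
  have hx0 : 0 < x := (Real.exp_pos 1).trans hx
  have hR := one_le_logRatio hx
  set y := Real.log x with hy
  have hy1 : 1 < y := (Real.lt_log_iff_exp_lt hx0).2 hx
  have hly : 0 < Real.log y := Real.log_pos hy1
  have hRy : logRatio x * Real.log y = y := by
    rw [logRatio, ← hy, div_mul_cancel₀ _ hly.ne']
  refine ⟨⌈12 * logRatio x⌉₊, Nat.ceil_pos.2 (by linarith), ?_, ?_⟩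
  · have := Nat.ceil_lt_add_one (a := 12 * logRatio x) (by linarith)
    linarith
  set N := ⌈12 * logRatio x⌉₊ with hN
  have hNR : 12 * logRatio x ≤ N := Nat.le_ceil _
  have hfac : (0 : ℝ) < N ! := by exact_mod_cast N.factorial_pos
  have hs : 0 < Real.sqrt y := Real.sqrt_pos.2 (by linarith)
  have h1 := Real.pow_div_factorial_le_exp (Real.sqrt y) hs.le N
  rw [div_le_iff₀ hfac] at h1
  have h2 : Real.sqrt y ^ N = Real.exp (N * (Real.log y / 2)) := by
    rw [← Real.log_sqrt (by linarith), ← Real.log_pow, Real.exp_log (pow_pos hs N)]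
  have h3 : Real.sqrt y ≤ y := by
    rw [Real.sqrt_le_left (by linarith)]
    nlinarith
  have h4 : 6 * y ≤ N * (Real.log y / 2) := by
    have := mul_le_mul_of_nonneg_right hNR hly.le
    nlinarith
  have h5 : Real.exp (6 * y - y) ≤ (N ! : ℝ) := by
    rw [Real.exp_sub, div_le_iff₀ (Real.exp_pos _), mul_comm (N ! : ℝ)]
    calc Real.exp (6 * y) ≤ Real.exp (N * (Real.log y / 2)) := Real.exp_le_exp.2 h4
      _ ≤ Real.exp (Real.sqrt y) * N ! := h2 ▸ h1
      _ ≤ Real.exp y * N ! := by gcongr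
  refine le_trans ?_ h5
  have h6 : Real.exp (6 * y - y) = Real.exp (4 * y) * x := by
    rw [← Real.exp_log hx0, ← Real.exp_add, ← hy]
    congr 1
    ring
  have h7 : (24 : ℝ) ≤ Real.exp (4 * y) := by
    have h8 : (3 : ℝ) ≤ Real.exp (2 * y) := by linarith [Real.add_one_le_exp (2 * y)]
    have h9 : (2.7 : ℝ) ≤ Real.exp y := by
      have := Real.exp_one_gt_d9
      have := Real.exp_le_exp.2 hy1.le
      linarith
    have h10 : Real.exp (4 * y) = Real.exp y ^ 4 := by
      rw [← Real.exp_nat_mul]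
      norm_num
    rw [h10]
    calc (24 : ℝ) ≤ 2.7 ^ 4 := by norm_num
      _ ≤ _ := by gcongr
  rw [h6]
  gcongr

theorem exists_two_pow {m : ℕ} (hm : 1 ≤ m) : ∃ q : ℕ, m ≤ 2 ^ q ∧ 2 ^ q ≤ 2 * m := by
  obtain ⟨q, h1, h2⟩ := exists_nat_pow_near hm one_lt_two
  exact ⟨q + 1, h2.le, by rw [pow_succ']; omega⟩

/-! ### The simulation circuit -/

/-- The expansion is padded with zero coefficients and identity strings, so that the label register
consists of whole qubits. -/
theorem exists_indexed_expansion {n k p : ℕ} {H : Op n} {α : ℝ} (hn : 1 ≤ n) (hα : 0 < α)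
    (hH : H.IsHermitian) (h : AbsComb (pauliLe n k) α H) (hp : (4 * n) ^ k ≤ 2 ^ p) :
    ∃ (b : Fin (2 ^ p) → ℝ) (P : Fin (2 ^ p) → Fin n → Pauli), (∀ i, pauliWeight (P i) ≤ k) ∧
      ∑ i, |b i| ≤ 1 ∧ ∑ i, (b i : ℂ) • pauliOp (P i) = (α : ℂ)⁻¹ • H := by
  obtain ⟨b, hb, hHb⟩ := exists_real_pauli_expansion hH h
  obtain ⟨e⟩ := Function.Embedding.nonempty_of_card_le
    (α := {P : Fin n → Pauli // pauliWeight P ≤ k}) (β := Fin (2 ^ p))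
    (by simpa using (card_pauliWeight_le hn k).trans hp)
  set b' : Fin (2 ^ p) → ℝ := Function.extend e (fun P => α⁻¹ * b P) 0 with hb'
  set P' : Fin (2 ^ p) → Fin n → Pauli := Function.extend e (fun P => P.1) fun _ _ => Pauli.I with hP'
  have hbe (P) : b' (e P) = α⁻¹ * b P := e.injective.extend_apply _ _ _
  have hPe (P) : P' (e P) = P.1 := e.injective.extend_apply _ _ _
  have hb0 (i) (hi : i ∉ Set.range e) : b' i = 0 :=
    Function.extend_apply' _ _ _ hi
  refine ⟨b', P', fun i => ?_, ?_, ?_⟩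
  · by_cases hi : i ∈ Set.range e
    · obtain ⟨P, rfl⟩ := hi
      rw [hPe]
      exact P.2
    · rw [hP', Function.extend_apply' _ _ _ hi]
      simp [pauliWeight]
  · rw [← Fintype.sum_of_injective e e.injective (fun P => |α⁻¹ * b P|) _
      (fun i hi => by rw [hb0 i hi, abs_zero]) fun P => by rw [hbe]]
    simp only [abs_mul, ← Finset.mul_sum]
    rw [abs_of_pos (inv_pos.2 hα), inv_mul_le_iff₀ hα, mul_one]
    exact hb
  · rw [← Fintype.sum_of_injective e e.injective
      (fun P => (α : ℂ)⁻¹ • ((b P : ℂ) • pauliOp P.1)) _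
      (fun i hi => by rw [hb0 i hi]; simp) fun P => by
        rw [hbe, hPe, smul_smul]; push_cast; rfl]
    rw [← Finset.smul_sum, ← hHb]

theorem norm_toLp_comp_equiv {X Y : Type*} [Fintype X] [Fintype Y] (f : Y ≃ X) (v : X → ℂ) :
    ‖(WithLp.toLp 2 (v ∘ f) : EuclideanSpace ℂ Y)‖ = ‖(WithLp.toLp 2 v : EuclideanSpace ℂ X)‖ := by
  rw [EuclideanSpace.norm_eq, EuclideanSpace.norm_eq]
  congr 1
  exact Equiv.sum_comp f fun x => ‖v x‖ ^ 2

theorem withAncilla_eq {n a : ℕ} {D C : Type} [Fintype D] [DecidableEq D] [Fintype C]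
    [DecidableEq C] (d₀ : D) (c₀ : C) (e : Qubits a ≃ D × C) (he : e 0 = (d₀, c₀)) (ψ : State n) :
    withAncilla a ψ = WithLp.toLp 2 (((emb (Qubits n × D) (Pi.single c₀ 1 : C → ℂ) *
      emb (Qubits n) (Pi.single d₀ 1 : D → ℂ)) *ᵥ ψ.ofLp) ∘
      ((Equiv.refl (Qubits n)).prodCongr e).trans (Equiv.prodAssoc (Qubits n) D C).symm) := by
  ext ⟨x, j⟩
  have h : (j = 0) ↔ (e j).1 = d₀ ∧ (e j).2 = c₀ := by
    rw [← e.injective.eq_iff, he, Prod.ext_iff]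
  rw [← mulVec_mulVec]
  simp only [withAncilla, emb, mulVec, dotProduct, h, Function.comp_apply, Equiv.trans_apply,
    Equiv.prodCongr_apply, Prod.map_apply, Equiv.prodAssoc_symm_apply, of_apply,
    Equiv.coe_refl, id_eq, Pi.single_apply, ite_mul, one_mul, zero_mul]
  simp only [Finset.sum_ite_eq, Finset.mem_univ, if_true]
  split_ifs <;> simp_all

theorem exists_simulation_circuit {n k p q N r : ℕ} {H : Op n} {α t : ℝ} (hn : 1 ≤ n)
    (hα : 0 < α) (ht : 0 < t) (hH : H.IsHermitian) (h : AbsComb (pauliLe n k) α H)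
    (hp : (4 * n) ^ k ≤ 2 ^ p) (hN : 0 < N) (hq : 2 * N ≤ 2 ^ q) (hr : 2 * (t * α) ≤ r)
    (hNf : 2 / (N ! : ℝ) ≤ 1) :
    ∃ W : Circuit n k (p + q + 2), pauliCount W = r * (3 * (N + 2 ^ q)) ∧ ∀ ψ : State n,
      ‖toEuclideanLin (circuitOp W) (withAncilla (p + q + 2) ψ) -
        withAncilla (p + q + 2) (toEuclideanLin (evolution H t) ψ)‖ ≤ r * (8 / (N ! : ℝ)) * ‖ψ‖ := by
  obtain ⟨b, P, hP, hb, hbH⟩ := exists_indexed_expansion hn hα hH h hp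
  have : NeZero (2 ^ p) := ⟨by positivity⟩
  have : NeZero (2 ^ q) := ⟨by positivity⟩
  set d₀ : Fin 2 × Fin (2 ^ p) := (0, 0)
  set c₀ : Fin 2 × Fin (2 ^ q) := (0, 0)
  obtain ⟨S, hS, hSH, hSb⟩ := exists_block_encoding b P hP hb d₀
  rw [hbH] at hSb
  obtain ⟨W, hW, hWH⟩ := exists_walk hS hSH hSb
  have htα : 0 < t * α := mul_pos ht hα
  have hr0 : (0 : ℝ) < r := by linarith
  set θ : ℝ := t * α / r with hθ
  have hθ0 : 0 ≤ θ := by positivity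
  have hθ1 : θ ≤ 1 / 2 := by
    rw [hθ, div_le_iff₀ hr0]
    linarith
  obtain ⟨G, hG, hGU⟩ := exists_segment hW hN hq (Equiv.refl _) hθ0 hθ1 hNf c₀
  set T := emb (Qubits n × (Fin 2 × Fin (2 ^ p))) (Pi.single c₀ 1 : Fin 2 × Fin (2 ^ q) → ℂ) with hT
  set T' := emb (Qubits n) (Pi.single d₀ 1 : Fin 2 × Fin (2 ^ p) → ℂ) with hT'
  have hT'T' : T'ᴴ * T' = 1 := emb_single_isometry d₀
  have nT' : ‖T'‖ ≤ 1 := norm_le_one_of_isometry hT'T'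
  set Q := (1 / 2 : ℂ) • (W + Wᴴ) with hQ
  set Y := (-(Complex.I * θ)) • Q with hY
  set U := NormedSpace.exp Y with hU
  have hQH : Qᴴ = Q := by
    rw [hQ, conjTranspose_smul, conjTranspose_add, conjTranspose_conjTranspose, add_comm]
    simp
  have hYH : Yᴴ = -Y := by
    rw [hY, conjTranspose_smul, hQH]
    simp
  have hUU : Uᴴ * U = 1 := by
    rw [hU, ← exp_conjTranspose, hYH, ← Matrix.exp_add_of_commute _ _ (Commute.refl Y).neg_left,
      neg_add_cancel, NormedSpace.exp_zero]
  -- The `r` segments of length `θ = tα / r` add up to `tα`, which compensates the normalisation `H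
  -- / α` of the encoded Hamiltonian.
  have hUr : U ^ r * T' = T' * evolution H t := by
    rw [hU, ← Matrix.exp_nsmul, evolution]
    refine exp_mul_eq_mul_exp ?_
    rw [hY, ← Nat.cast_smul_eq_nsmul ℂ, smul_smul, Matrix.smul_mul, hWH, Matrix.mul_smul,
      Matrix.mul_smul, smul_smul]
    congr 1
    have h1 : (r : ℂ) ≠ 0 := by exact_mod_cast hr0.ne'
    have h2 : (α : ℂ) ≠ 0 := by exact_mod_cast hα.ne'
    rw [hθ]
    push_cast
    field_simp
  have hsim : ‖G ^ r * (T * T') - T * T' * evolution H t‖ ≤ r * (8 / (N ! : ℝ)) := by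
    have h1 := norm_pow_mul_sub_le (norm_le_one_of_isometry hG.conjTranspose_mul_self)
      (norm_le_one_of_isometry hUU) hGU r
    have h2 : G ^ r * (T * T') - T * T' * evolution H t = (G ^ r * T - T * U ^ r) * T' := by
      rw [Matrix.sub_mul, Matrix.mul_assoc T, ← hUr]
      simp only [Matrix.mul_assoc]
    rw [h2]
    calc _ ≤ ‖G ^ r * T - T * U ^ r‖ * ‖T'‖ := l2_opNorm_mul _ _
      _ ≤ r * (8 / (N ! : ℝ)) * 1 := by gcongr
      _ = _ := mul_one _
  obtain ⟨e₀⟩ : Nonempty (Qubits (p + q + 2) ≃ (Fin 2 × Fin (2 ^ p)) × (Fin 2 × Fin (2 ^ q))) := by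
    refine ⟨Fintype.equivOfCardEq ?_⟩
    simp only [Fintype.card_pi, Fintype.card_fin, Finset.prod_const, Finset.card_univ,
      Fintype.card_prod]
    ring
  -- Any bijection with the bit strings will do, since ancilla unitaries are free; the swap makes
  -- `|0…0⟩` the initial state of both registers.
  set e := e₀.trans (Equiv.swap (e₀ 0) (d₀, c₀)) with he
  have he0 : e 0 = (d₀, c₀) := by simp [he]
  obtain ⟨V, hVc, hV⟩ := Impl.exists_circuit (hG.pow r) e
  refine ⟨V, by rw [hVc, mul_one], fun ψ => ?_⟩
  set f := ((Equiv.refl (Qubits n)).prodCongr e).trans (Equiv.prodAssoc (Qubits n) _ _).symm with hf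
  have hV' : circuitOp V = (G ^ r).submatrix f f := by
    rw [hV]
    rfl
  have key : toEuclideanLin (circuitOp V) (withAncilla (p + q + 2) ψ) -
      withAncilla (p + q + 2) (toEuclideanLin (evolution H t) ψ) =
      WithLp.toLp 2 (((G ^ r * (T * T') - T * T' * evolution H t) *ᵥ ψ.ofLp) ∘ f) := by
    rw [withAncilla_eq d₀ c₀ e he0, withAncilla_eq d₀ c₀ e he0, toLpLin_apply, toLpLin_apply, hV',
      submatrix_mulVec_equiv, ← WithLp.toLp_sub, sub_mulVec, ← mulVec_mulVec, ← mulVec_mulVec]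
    congr 1
    ext1 x
    simp [Function.comp_def, hT, hT', hf, Matrix.mul_assoc]
  rw [key, norm_toLp_comp_equiv]
  refine (l2_opNorm_mulVec _ ψ).trans ?_
  gcongr

end

/-! ### Selection rules -/

/-- `U v` is again an eigenvector of `A` for the eigenvalue `a`, and eigenspaces of a Hermitian
operator are orthogonal. -/
theorem inner_eq_zero_of_commute {ι : Type*} [Fintype ι] [DecidableEq ι] {A U : Matrix ι ι ℂ}
    (hA : A.IsHermitian) (hAU : Commute A U) {v v' : EuclideanSpace ℂ ι} {a a' : ℝ}
    (hv : toEuclideanLin A v = (a : ℂ) • v) (hv' : toEuclideanLin A v' = (a' : ℂ) • v')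
    (hne : a ≠ a') : inner ℂ v' (toEuclideanLin U v) = 0 := by
  have h1 : toEuclideanLin A (toEuclideanLin U v) = (a : ℂ) • toEuclideanLin U v := by
    rw [← map_smul, ← hv]
    simp only [toLpLin_apply, mulVec_mulVec]
    rw [hAU.eq]
  have h2 : inner ℂ (toEuclideanLin A v') (toEuclideanLin U v) =
      inner ℂ v' (toEuclideanLin A (toEuclideanLin U v)) :=
    (isSymmetric_toEuclideanLin_iff.2 hA) _ _
  rw [h1, hv', inner_smul_left, inner_smul_right, Complex.conj_ofReal] at h2
  have h3 : ((a' : ℂ) - a) * inner ℂ v' (toEuclideanLin U v) = 0 := by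
    rw [sub_mul, h2, sub_self]
  refine (mul_eq_zero.1 h3).resolve_left (sub_ne_zero.2 ?_)
  exact_mod_cast hne.symm

theorem commute_evolution {n : ℕ} {A : Op n} (hA : ∀ σ, Commute A (permRep n σ)) (f : GroupAlg n)
    (t : ℝ) : Commute A (evolution (algRep n f) t) := by
  refine Commute.exp_right (Commute.smul_right ?_ _)
  rw [algRep_eq_sum]
  exact Commute.sum_right _ _ _ fun σ _ => (hA σ).smul_right _

/-- The number of qubits in state `1`. -/
def weightOp (n : ℕ) : Op n :=
  diagonal fun x => ((Finset.univ.filter fun i => x i = 1).card : ℂ)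

theorem weightOp_isHermitian (n : ℕ) : (weightOp n).IsHermitian := by
  refine isHermitian_diagonal_of_self_adjoint _ ?_
  ext1 x
  simp

theorem weightOp_commute {n : ℕ} (σ : Equiv.Perm (Fin n)) : Commute (weightOp n) (permRep n σ) := by
  ext y x
  simp only [weightOp, diagonal_mul, mul_diagonal, permRep, MonoidHom.coe_mk, OneHom.coe_mk,
    of_apply]
  split_ifs with h
  · subst h
    rw [mul_one, one_mul]
    congr 1
    refine Finset.card_bij (fun i _ => σ⁻¹ i) (fun i hi => by simpa using hi)
      (fun i _ j _ h => σ⁻¹.injective h) fun i hi => ⟨σ i, by simpa using hi, by simp⟩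
  · simp

theorem weightOp_apply {n m : ℕ} {v : State n}
    (hv : ∀ x : Qubits n, (Finset.univ.filter fun i => x i = 1).card ≠ m → v x = 0) :
    toEuclideanLin (weightOp n) v = ((m : ℝ) : ℂ) • v := by
  ext x
  simp only [toLpLin_apply, weightOp, mulVec_diagonal, PiLp.smul_apply, smul_eq_mul]
  by_cases h : (Finset.univ.filter fun i => x i = 1).card = m
  · rw [h]
    simp
  · rw [hv x h]
    simp

/-- The sum of all `π((i j))`. -/
def swapSum (n : ℕ) : Op n := ∑ i, ∑ j, permRep n (Equiv.swap i j)

/-- Conjugation by `σ` only permutes the transpositions. -/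
theorem swapSum_commute {n : ℕ} (σ : Equiv.Perm (Fin n)) : Commute (swapSum n) (permRep n σ) := by
  have h (i j : Fin n) : permRep n σ * permRep n (Equiv.swap i j) =
      permRep n (Equiv.swap (σ i) (σ j)) * permRep n σ := by
    rw [← map_mul, ← map_mul, Equiv.mul_swap_eq_swap_mul]
  refine Commute.symm ?_
  rw [Commute, SemiconjBy, swapSum, Finset.mul_sum, Finset.sum_mul,
    ← Equiv.sum_comp σ (fun i => (∑ j, permRep n (Equiv.swap i j)) * permRep n σ)]
  refine Finset.sum_congr rfl fun i _ => ?_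
  rw [Finset.mul_sum, Finset.sum_mul, ← Equiv.sum_comp σ (fun j =>
    permRep n (Equiv.swap (σ i) j) * permRep n σ)]
  exact Finset.sum_congr rfl fun j _ => h i j

theorem swapSum_isHermitian (n : ℕ) : (swapSum n).IsHermitian := by
  rw [IsHermitian, swapSum, conjTranspose_sum]
  refine Finset.sum_congr rfl fun i _ => ?_
  rw [conjTranspose_sum]
  refine Finset.sum_congr rfl fun j _ => ?_
  rcases eq_or_ne i j with rfl | hij
  · rw [Equiv.swap_self, ← Equiv.Perm.one_def, map_one, conjTranspose_one]
  · rw [permRep_swap_eq_pauliOp hij, conjTranspose_smul]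
    simp [conjTranspose_add, pauliOp_conjTranspose]

/-- Every transposition comes from two ordered pairs, and each of the `n` diagonal pairs gives the
identity. -/
theorem swapSum_eq (n : ℕ) :
    swapSum n = (2 : ℂ) • ∑ i, algRep n (yjm i) + (n : ℂ) • (1 : Op n) := by
  have h1 (i : Fin n) : algRep n (yjm i) = ∑ j, if j < i then permRep n (Equiv.swap i j) else 0 := by
    rw [yjm, map_sum, Finset.sum_filter]
    refine Finset.sum_congr rfl fun j _ => ?_
    split_ifs
    · rw [algRep, MonoidAlgebra.lift_single, one_smul, Equiv.swap_comm]
    · rfl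
  have h2 : ∑ i : Fin n, ∑ j : Fin n, (if i < j then permRep n (Equiv.swap i j) else 0) =
      ∑ i : Fin n, ∑ j : Fin n, if j < i then permRep n (Equiv.swap i j) else 0 := by
    rw [Finset.sum_comm]
    refine Finset.sum_congr rfl fun i _ => Finset.sum_congr rfl fun j _ => ?_
    rw [Equiv.swap_comm]
  have h3 : ∑ i : Fin n, ∑ j : Fin n, (if i = j then (1 : Op n) else 0) = (n : ℂ) • (1 : Op n) := by
    simp [← Nat.cast_smul_eq_nsmul ℂ]
  have h4 : swapSum n = ∑ i : Fin n, ∑ j : Fin n,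
      ((if j < i then permRep n (Equiv.swap i j) else 0) +
        (if i < j then permRep n (Equiv.swap i j) else 0) + if i = j then (1 : Op n) else 0) := by
    rw [swapSum]
    refine Finset.sum_congr rfl fun i _ => Finset.sum_congr rfl fun j _ => ?_
    rcases lt_trichotomy i j with h | rfl | h
    · simp [h, h.ne, h.not_gt]
    · simp [Equiv.swap_self, ← Equiv.Perm.one_def]
    · simp [h, h.ne', h.not_gt]
  rw [h4]
  simp only [Finset.sum_add_distrib, h1]
  rw [h2, h3, two_smul]

theorem swapSum_apply {n : ℕ} {lam : YoungDiagram} {T : StdTableau n lam} {v : State n}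
    (hv : ∀ i, toEuclideanLin (algRep n (yjm i)) v = (T.content i : ℂ) • v) :
    toEuclideanLin (swapSum n) v = (((2 * ∑ i, T.content i + n : ℤ) : ℝ) : ℂ) • v := by
  rw [swapSum_eq, map_add, map_smul, map_sum, map_smul, LinearMap.add_apply, LinearMap.smul_apply,
    LinearMap.sum_apply, LinearMap.smul_apply]
  simp only [hv, ← Finset.sum_smul, smul_smul]
  rw [show toEuclideanLin (1 : Op n) v = v by simp, ← add_smul]
  push_cast
  rfl

/-! ### Contents of two-row diagrams -/

theorem two_mul_sum_content {n : ℕ} {lam : YoungDiagram} (T : StdTableau n lam)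
    (h : lam.colLen 0 ≤ 2) :
    2 * ∑ i, T.content i = lam.rowLen 0 * (lam.rowLen 0 - 1 : ℤ) +
      lam.rowLen 1 * (lam.rowLen 1 - 1 : ℤ) - 2 * lam.rowLen 1 ∧
    (n : ℤ) = lam.rowLen 0 + lam.rowLen 1 := by
  have hcells : lam.cells = lam.row 0 ∪ lam.row 1 := by
    ext c
    rw [Finset.mem_union, YoungDiagram.mem_row_iff, YoungDiagram.mem_row_iff, ← and_or_left,
      YoungDiagram.mem_cells, iff_self_and]
    intro hc
    have h1 : (c.1, 0) ∈ lam := lam.up_left_mem le_rfl (Nat.zero_le _) hc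
    rw [YoungDiagram.mem_iff_lt_colLen] at h1
    omega
  have hdisj : Disjoint (lam.row 0) (lam.row 1) := by
    rw [Finset.disjoint_left]
    intro c h0 h1
    rw [YoungDiagram.mem_row_iff] at h0 h1
    omega
  have hrange (a : ℕ) : 2 * ∑ j ∈ Finset.range a, (j : ℤ) = a * (a - 1 : ℤ) := by
    induction a with
    | zero => simp
    | succ a ih =>
      rw [Finset.sum_range_succ, mul_add, ih]
      push_cast
      ring
  constructor
  · have h1 : ∑ i, T.content i = ∑ c ∈ lam.cells, ((c.2 : ℤ) - c.1) := by
      rw [← T.image_eq, Finset.sum_image fun i _ j _ h => T.injective h]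
      rfl
    rw [h1, hcells, Finset.sum_union hdisj, YoungDiagram.row_eq_prod, YoungDiagram.row_eq_prod,
      Finset.sum_product, Finset.sum_product]
    simp only [Finset.sum_singleton, Nat.cast_zero, Nat.cast_one, Finset.card_singleton,
      Finset.sum_sub_distrib,
      Finset.sum_const, Finset.card_range, nsmul_eq_mul, mul_one,
      one_mul, mul_zero]
    linarith [hrange (lam.rowLen 0), hrange (lam.rowLen 1)]
  · have h1 : lam.cells.card = n := by
      rw [← T.image_eq, Finset.card_image_of_injective _ T.injective]
      simp
    rw [hcells, Finset.card_union_of_disjoint hdisj, ← YoungDiagram.rowLen_eq_card,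
      ← YoungDiagram.rowLen_eq_card] at h1
    exact_mod_cast h1.symm

/-- For row lengths `a ≥ b` with `a + b = n` fixed, moving a box from the second row to the first
strictly increases the content sum, so that sum determines `a`. -/
theorem eq_of_sum_content_eq {n : ℕ} {lam lam' : YoungDiagram} {T : StdTableau n lam}
    {T' : StdTableau n lam'} (h : lam.colLen 0 ≤ 2) (h' : lam'.colLen 0 ≤ 2)
    (hc : ∑ i, T.content i = ∑ i, T'.content i) : lam' = lam := by
  obtain ⟨h1, h2⟩ := two_mul_sum_content T h
  obtain ⟨h1', h2'⟩ := two_mul_sum_content T' h'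
  rw [hc, h1'] at h1
  have h3 := lam.rowLen_anti 0 1 zero_le_one
  have h3' := lam'.rowLen_anti 0 1 zero_le_one
  have h4 (μ : YoungDiagram) (hμ : μ.colLen 0 ≤ 2) (i : ℕ) : μ.rowLen (i + 2) = 0 := by
    by_contra h0
    have h5 : (i + 2, 0) ∈ μ := YoungDiagram.mem_iff_lt_rowLen.2 (Nat.pos_of_ne_zero h0)
    rw [YoungDiagram.mem_iff_lt_colLen] at h5
    omega
  have h6 : lam'.rowLen 0 = lam.rowLen 0 := by
    zify at h3 h3' ⊢
    generalize (lam.rowLen 0 : ℤ) = a, (lam.rowLen 1 : ℤ) = b, (lam'.rowLen 0 : ℤ) = a',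
      (lam'.rowLen 1 : ℤ) = b' at *
    obtain rfl : b' = a + b - a' := by linarith
    rcases lt_trichotomy a' a with h7 | h7 | h7
    · nlinarith
    · exact h7
    · nlinarith
  have h7 : lam'.rowLen 1 = lam.rowLen 1 := by omega
  have h8 (i : ℕ) : lam'.rowLen i = lam.rowLen i := by
    match i with
    | 0 => exact h6
    | 1 => exact h7
    | i + 2 => rw [h4 _ h, h4 _ h']
  refine YoungDiagram.ext (Finset.ext fun c => ?_)
  obtain ⟨i, j⟩ := c
  rw [YoungDiagram.mem_cells, YoungDiagram.mem_cells, YoungDiagram.mem_iff_lt_rowLen,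
    YoungDiagram.mem_iff_lt_rowLen, h8]

theorem inner_evolution_eq_zero {n : ℕ} (f : GroupAlg n) (t : ℝ) {lam lam' : YoungDiagram}
    {T : StdTableau n lam} {T' : StdTableau n lam'} {m m' : ℕ} {v v' : State n}
    (h : lam.colLen 0 ≤ 2) (h' : lam'.colLen 0 ≤ 2) (hv : IsYoungVector T m v)
    (hv' : IsYoungVector T' m' v') (hne : ¬ (lam' = lam ∧ m' = m)) :
    inner ℂ v' (toEuclideanLin (evolution (algRep n f) t) v) = 0 := by
  by_cases hm : m' = m
  · refine inner_eq_zero_of_commute (swapSum_isHermitian n) (commute_evolution swapSum_commute f t)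
      (swapSum_apply hv.2.2) (swapSum_apply hv'.2.2) fun hc => hne ⟨?_, hm⟩
    refine eq_of_sum_content_eq (T := T) (T' := T') h h' ?_
    have hc' := Int.cast_injective hc
    linarith
  · refine inner_eq_zero_of_commute (weightOp_isHermitian n) (commute_evolution weightOp_commute f t)
      (weightOp_apply hv.2.1) (weightOp_apply hv'.2.1) fun hc => hm ?_
    exact_mod_cast hc.symm

/-! ### Matrix elements and the final resource bounds -/

section

open scoped Nat

theorem withAncilla_inner {n a : ℕ} (v w : State n) :
    inner ℂ (withAncilla a v) (withAncilla a w) = inner ℂ v w := by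
  simp only [PiLp.inner_apply, withAncilla, Fintype.sum_prod_type]
  refine Finset.sum_congr rfl fun x _ => ?_
  rw [Finset.sum_eq_single 0] <;> simp +contextual

theorem norm_withAncilla {n a : ℕ} (v : State n) : ‖withAncilla a v‖ = ‖v‖ := by
  rw [norm_eq_sqrt_re_inner (𝕜 := ℂ), withAncilla_inner, ← norm_eq_sqrt_re_inner]

/-- Adjoining `|0…0⟩` preserves inner products, so Cauchy-Schwarz for unit vectors suffices. -/
theorem norm_inner_sub_inner_le {n a : ℕ} {M : Matrix (Joint n a) (Joint n a) ℂ} {U : Op n} {ε : ℝ}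
    (h : ∀ ψ : State n, ‖toEuclideanLin M (withAncilla a ψ) -
      withAncilla a (toEuclideanLin U ψ)‖ ≤ ε * ‖ψ‖) {v v' : State n} (hv : ‖v‖ = 1)
    (hv' : ‖v'‖ = 1) :
    ‖inner ℂ (withAncilla a v') (toEuclideanLin M (withAncilla a v)) -
      inner ℂ v' (toEuclideanLin U v)‖ ≤ ε := by
  rw [← withAncilla_inner (a := a) v', ← inner_sub_right]
  refine (norm_inner_le_norm _ _).trans ?_
  rw [norm_withAncilla, hv', one_mul]
  simpa [hv] using h v

theorem exists_simulation : ∃ A : ℝ, 0 < A ∧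
    ∀ (n k : ℕ) (f : GroupAlg n) (t ε : ℝ),
      1 ≤ k → IsLocal k f → (algRep n f).IsHermitian → 0 < t → 0 < ε →
      1 ≤ t * lConst k f * (n : ℝ) ^ k →
      Real.exp 1 < t * lConst k f * (n : ℝ) ^ k / ε →
      ∃ (a : ℕ) (W : Circuit n k a),
        (pauliCount W : ℝ) ≤
          A * (t * lConst k f * (n : ℝ) ^ k * logRatio (t * lConst k f * (n : ℝ) ^ k / ε)) ∧
        (a : ℝ) ≤
          A * Real.log ((4 * (n : ℝ)) ^ k * logRatio (t * lConst k f * (n : ℝ) ^ k / ε)) ∧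
        ∀ ψ : State n,
          ‖toEuclideanLin (circuitOp W) (withAncilla a ψ) -
              withAncilla a (toEuclideanLin (evolution (algRep n f) t) ψ)‖
            ≤ ε * ‖ψ‖ := by
  refine ⟨600, by norm_num, fun n k f t ε hk hf hH ht hε hτ1 hx => ?_⟩
  have hn : 1 ≤ n := by
    rcases Nat.eq_zero_or_pos n with rfl | hn
    · exfalso
      rw [Nat.cast_zero, zero_pow (by omega), mul_zero] at hτ1
      linarith
    · exact hn
  set α : ℝ := lConst k f * (n : ℝ) ^ k with hα
  set τ : ℝ := t * lConst k f * (n : ℝ) ^ k with hτ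
  have hτα : t * α = τ := by rw [hα, hτ, mul_assoc]
  have hα0 : 0 < α := pos_of_mul_pos_right (by rw [hτα]; linarith) ht.le
  set R := logRatio (τ / ε) with hR
  have hR1 : 1 ≤ R := one_le_logRatio hx
  obtain ⟨N, hN, hNR, hNf⟩ := exists_truncation_order hx
  obtain ⟨q, hq, hq'⟩ := exists_two_pow (m := 2 * N) (by omega)
  obtain ⟨p, hp, hp'⟩ := exists_two_pow (m := (4 * n) ^ k) (Nat.one_le_pow _ _ (by omega))
  have hr : 2 * τ ≤ ⌈2 * τ⌉₊ := Nat.le_ceil _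
  have hr' : (⌈2 * τ⌉₊ : ℝ) ≤ 3 * τ := by
    have := Nat.ceil_lt_add_one (a := 2 * τ) (by linarith)
    linarith
  generalize ⌈2 * τ⌉₊ = r at hr hr'
  have hN0 : (0 : ℝ) < N ! := by exact_mod_cast N.factorial_pos
  have hx1 : 1 < τ / ε := by
    have := Real.add_one_le_exp 1
    linarith
  have hNf1 : 2 / (N ! : ℝ) ≤ 1 := by
    rw [div_le_one hN0]
    linarith
  obtain ⟨W, hWc, hW⟩ := exists_simulation_circuit hn hα0 ht hH (absComb_algRep hn hk hf) hp hN hq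
    (by rw [hτα]; exact hr) hNf1
  have hqR : (2 : ℝ) ^ q ≤ 4 * N := by
    have : ((2 ^ q : ℕ) : ℝ) ≤ ((2 * (2 * N) : ℕ) : ℝ) := by exact_mod_cast hq'
    push_cast at this
    linarith
  have hpR : (2 : ℝ) ^ p ≤ 2 * (4 * (n : ℝ)) ^ k := by exact_mod_cast hp'
  have hM4 : (4 : ℝ) ≤ (4 * (n : ℝ)) ^ k := by
    have hn' : (1 : ℝ) ≤ n := by exact_mod_cast hn
    calc (4 : ℝ) ≤ 4 * n := by linarith
      _ ≤ (4 * (n : ℝ)) ^ k := le_self_pow₀ (by linarith) (by omega)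
  refine ⟨p + q + 2, W, ?_, ?_, fun ψ => (hW ψ).trans ?_⟩
  · rw [hWc]
    push_cast
    -- From `N ≤ 13 R` and `2 ^ q ≤ 4 N`, the factor is `3 * (13 + 52) = 195`; with `r ≤ 3τ` the
    -- total is `585 τR`.
    have h1 : 3 * ((N : ℝ) + 2 ^ q) ≤ 195 * R := by linarith
    calc (r : ℝ) * (3 * (N + 2 ^ q)) ≤ 3 * τ * (195 * R) := by gcongr
      _ ≤ 600 * (τ * R) := by nlinarith [mul_pos (zero_lt_one.trans_le hτ1) (zero_lt_one.trans_le hR1)]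
  · set M := (4 * (n : ℝ)) ^ k * R with hM
    have hM4' : 4 ≤ M := by nlinarith
    -- The dimension is at most `2 * 52 * 4 = 416` times `M`. As `M ≥ 4`, the constant `9 log 2` is
    -- absorbed into a multiple of `log M`.
    have h2a : (2 : ℝ) ^ (p + q + 2) ≤ 2 ^ 9 * M := by
      calc (2 : ℝ) ^ (p + q + 2) = 2 ^ p * 2 ^ q * 4 := by ring
        _ ≤ (2 * (4 * (n : ℝ)) ^ k) * (4 * (13 * R)) * 4 := by
          gcongr
          linarith
        _ ≤ 2 ^ 9 * M := by
          rw [hM]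
          nlinarith [mul_pos (lt_of_lt_of_le four_pos hM4) (zero_lt_one.trans_le hR1)]
    have hlog := Real.log_le_log (by positivity) h2a
    rw [Real.log_mul (by norm_num) (by linarith), Real.log_pow, Real.log_pow] at hlog
    have h2M : 2 * Real.log 2 ≤ Real.log M := by
      have := Real.log_le_log (by norm_num) hM4'
      rwa [show (4 : ℝ) = 2 ^ 2 by norm_num, Real.log_pow] at this
    have hl2 := Real.log_two_gt_d9
    have h3 : ((p + q + 2 : ℕ) : ℝ) * 0.5 ≤ ((p + q + 2 : ℕ) : ℝ) * Real.log 2 := by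
      gcongr
      linarith
    push_cast at hlog h3 ⊢
    linarith
  · gcongr
    calc (r : ℝ) * (8 / (N ! : ℝ)) ≤ 3 * τ * (8 / (N ! : ℝ)) := by gcongr
      _ = 24 * (τ / ε) / (N ! : ℝ) * ε := by
        field_simp
        ring
      _ ≤ 1 * ε := by
        gcongr
        rwa [div_le_one hN0]
      _ = ε := one_mul ε

end

end QubitSim

end

theorem mainTheorem6 :
    -- the spin form of a transposition
    (∀ (n : ℕ) (i j : Fin n), i ≠ j →
      permRep n (Equiv.swap i j) = (2 : ℂ) • spinDot i j + (1 / 2 : ℂ) • (1 : Op n)) ∧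
    -- the evolution does not connect different irreps or permutation modules
    (∀ (n : ℕ) (f : GroupAlg n) (t : ℝ) (lam lam' : YoungDiagram)
      (T : StdTableau n lam) (T' : StdTableau n lam') (m m' : ℕ) (v v' : State n),
      lam.colLen 0 ≤ 2 → lam'.colLen 0 ≤ 2 →
      IsYoungVector T m v → IsYoungVector T' m' v' → ¬ (lam' = lam ∧ m' = m) →
      inner ℂ v' (Matrix.toEuclideanLin (evolution (algRep n f) t) v) = 0) ∧
    -- simulation of the evolution and of its matrix elements
    ∃ A : ℝ, 0 < A ∧
      ∀ (n k : ℕ) (f : GroupAlg n) (t ε : ℝ),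
        1 ≤ k → IsLocal k f → (algRep n f).IsHermitian → 0 < t → 0 < ε →
        1 ≤ t * lConst k f * (n : ℝ) ^ k →
        Real.exp 1 < t * lConst k f * (n : ℝ) ^ k / ε →
        ∃ (a : ℕ) (W : Circuit n k a),
          (pauliCount W : ℝ) ≤
            A * (t * lConst k f * (n : ℝ) ^ k * logRatio (t * lConst k f * (n : ℝ) ^ k / ε)) ∧
          (a : ℝ) ≤
            A * Real.log ((4 * (n : ℝ)) ^ k * logRatio (t * lConst k f * (n : ℝ) ^ k / ε)) ∧
          (∀ ψ : State n,
            ‖Matrix.toEuclideanLin (circuitOp W) (withAncilla a ψ) -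
                withAncilla a (Matrix.toEuclideanLin (evolution (algRep n f) t) ψ)‖
              ≤ ε * ‖ψ‖) ∧
          ∀ (lam lam' : YoungDiagram) (T : StdTableau n lam) (T' : StdTableau n lam')
            (m m' : ℕ) (v v' : State n),
            IsYoungVector T m v → IsYoungVector T' m' v' →
            ‖inner ℂ (withAncilla a v')
                  (Matrix.toEuclideanLin (circuitOp W) (withAncilla a v)) -
                inner ℂ v' (Matrix.toEuclideanLin (evolution (algRep n f) t) v)‖ ≤ ε := by
  refine ⟨fun n i j hij => permRep_swap hij, fun n f t lam lam' T T' m m' v v' h h' hv hv' hne =>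
    inner_evolution_eq_zero f t h h' hv hv' hne, ?_⟩
  obtain ⟨A, hA, hsim⟩ := exists_simulation
  refine ⟨A, hA, fun n k f t ε hk hf hH ht hε h1 h2 => ?_⟩
  obtain ⟨a, W, hW, ha, hψ⟩ := hsim n k f t ε hk hf hH ht hε h1 h2
  exact ⟨a, W, hW, ha, hψ, fun _ _ _ _ _ _ _ _ hv hv' => norm_inner_sub_inner_le hψ hv.1 hv'.1⟩
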